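/- **Data.** Let $\mathrm{IP}$ be a set of addresses and $\mathrm{DATA}$ a set of data packets. A *route* is a tuple $(dip,dsn,dsk,flag,hops,nhip,pre)$ with $dip,nhip\in\mathrm{IP}$, $dsn,hops\in\mathbb N$, $dsk\in\{\mathsf{kno},\mathsf{unk}\}$, $flag\in\{\mathsf{val},\mathsf{inval}\}$, $pre\subseteq\mathrm{IP}$. A *routing table* $rt$ is a set of routes with pairwise different $dip$; $vD(rt)$ and $iD(rt)$ are the sets of destinations of its valid and invalid routes; $sqn,sqnf,dhops,nhop,precs$ return the components $dsn,dsk,hops,nhip,pre$ of the entry for a destination (if there is none, $sqn=0$, $sqnf=\mathsf{unk}$, and the others are undefined). $addpreRT(rt,dip,npre)$ adds $npre$ to the precursors of the entry for $dip$ (undefined if there is none). $invalidate(rt,dests)$ sets $flag:=\mathsf{inval}$ and $dsn:=rsn$ in the entry for $rip$, for each $(rip,rsn)$ in the partial function $dests:\mathrm{IP}\rightharpoonup\mathbb N$. $inc(0)=0$, $inc(n)=n+1$ for $n>0$. For a route $r$ with $flag=\mathsf{val}$, ($dsn=0\Leftrightarrow dsk=\mathsf{unk}$) and ($dsk=\mathsf{unk}\Rightarrow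 hops=1$), $update(rt,r)$ is obtained thus ($update$ is undefined for other $r$): if $rt$ has no entry for the destination of $r$, add $r$; otherwise let $s$ be that entry. If $dsn_s<dsn_r$, or $dsn_s=dsn_r$ and ($hops_r<hops_s$ or $flag_s=\mathsf{inval}$), replace $s$ by $r$ with $pre:=pre_r\cup pre_s$; else, if $dsk_r=\mathsf{unk}$, replace $s$ by $r$ with $pre:=pre_r\cup pre_s$ and $dsn:=dsn_s$; else only replace $pre_s$ by $pre_s\cup pre_r$. A *store* assigns to some addresses a flag in $\{\mathsf{req},\mathsf{noReq}\}$ and a queue of data packets. The messages are $\mathrm{rreq}(hops,rreqid,dip,dsn,dsk,oip,osn,sip)$, $\mathrm{rrep}(hops,dip,dsn,oip,sip)$, $\mathrm{rerr}(dests,sip)$, $\mathrm{newpkt}(data,dip)$ and $\mathrm{pkt}(data,dip,sip)$. **The node process.** Every node $ip$ keeps variables $ip$, $sn\in\mathbb N$, $rt$, $rreqs\subseteq\mathrm{IP}\times\mathbb N$ and $store$, and runs the process $\mathrm{AODV}$, which takes its input messages, one at a time, from a first-in-first-out queue process $\mathrm{QMSG}$ running in parallel on the same node, which is always ready to receive messages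 arriving at the node. The steps below are performed one by one (assignments, evaluations of guards, the transfer of a message from the queue and process-internal steps being silent; no step is taken if an expression in it is undefined); between them, steps of other nodes, of the queue and of the environment may occur. Write $\mathrm{Err}$ for: $rt:=invalidate(rt,dests)$; set the flag in $store$ to $\mathsf{req}$ for all stored destinations in $dests$; $pre:=\bigcup\{precs(rt,rip)\mid (rip,*)\in dests\}$; delete from $dests$ all pairs with $precs(rt,rip)=\emptyset$; groupcast $\mathrm{rerr}(dests,ip)$ to $pre$; return to $\mathrm{AODV}$. Write $\mathrm{Break}(d)$ for: $dests:=\{(rip,inc(sqn(rt,rip)))\mid rip\in vD(rt),\ nhop(rt,rip)=nhop(rt,d)\}$; $\mathrm{Err}$. After each alternative the process returns to $\mathrm{AODV}$. $\mathrm{AODV}$ chooses nondeterministically between the following. 1. Take the next message from the queue. If it is an $\mathrm{rreq}$, $\mathrm{rrep}$ or $\mathrm{rerr}$ with sender $sip$, first $rt:=update(rt,(sip,0,\mathsf{unk},\mathsf{val},1,sip,\emptyset))$. Then: * $\mathrm{newpkt}(data,dip)$: if $dip=ip$, deliver $data$; otherwise append it to the queue for $dip$ in $store$ (a new queue has flag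 $\mathsf{req}$). * $\mathrm{pkt}(data,dip,oip)$: if $dip=ip$, deliver $data$. Otherwise, if $dip\in vD(rt)$, unicast $\mathrm{pkt}(data,dip,oip)$ to $nhop(rt,dip)$, and on failure $\mathrm{Break}(dip)$; if $dip\notin vD(rt)$ and $dip\in iD(rt)$, groupcast $\mathrm{rerr}(\{(dip,sqn(rt,dip))\},ip)$ to $precs(rt,dip)$; if $dip\notin vD(rt)\cup iD(rt)$, do nothing. * $\mathrm{rreq}(hops,rreqid,dip,dsn,dsk,oip,osn,sip)$: if $(oip,rreqid)\in rreqs$, do nothing. Otherwise $rt:=update(rt,(oip,osn,\mathsf{kno},\mathsf{val},hops+1,sip,\emptyset))$; $rreqs:=rreqs\cup\{(oip,rreqid)\}$. If $dip=ip$: $sn:=\max(sn,dsn)$, unicast $\mathrm{rrep}(0,dip,sn,oip,ip)$ to $nhop(rt,oip)$, and on failure $\mathrm{Break}(oip)$. If $dip\ne ip$, $dip\in vD(rt)$, $dsn\le sqn(rt,dip)$ and $sqnf(rt,dip)=\mathsf{kno}$: $rt:=addpreRT(rt,dip,\{sip\})$; $rt:=addpreRT(rt,oip,\{nhop(rt,dip)\})$;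 unicast $\mathrm{rrep}(dhops(rt,dip),dip,sqn(rt,dip),oip,ip)$ to $nhop(rt,oip)$, and on failure $\mathrm{Break}(oip)$. In the remaining case broadcast $\mathrm{rreq}(hops+1,rreqid,dip,\max(sqn(rt,dip),dsn),dsk,oip,osn,ip)$. * $\mathrm{rrep}(hops,dip,dsn,oip,sip)$: let $rt'=update(rt,(dip,dsn,\mathsf{kno},\mathsf{val},hops+1,sip,\emptyset))$. If $rt'=rt$, do nothing. Otherwise $rt:=rt'$, and if $oip\ne ip$ and $oip\in vD(rt)$: $rt:=addpreRT(rt,dip,\{nhop(rt,oip)\})$; $rt:=addpreRT(rt,nhop(rt,dip),\{nhop(rt,oip)\})$; unicast $\mathrm{rrep}(hops+1,dip,dsn,oip,ip)$ to $nhop(rt,oip)$, and on failure $\mathrm{Break}(oip)$. * $\mathrm{rerr}(dests,sip)$: restrict $dests$ to the pairs $(rip,rsn)$ with $rip\in vD(rt)$, $nhop(rt,rip)=sip$ and $sqn(rt,rip)<rsn$; then $\mathrm{Err}$. 2. For some $dip\in vD(rt)$ with a queue in $store$: unicast $\mathrm{pkt}(data,dip,ip)$ to $nhop(rt,dip)$,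 where $data$ is the oldest packet in that queue; on success drop this packet from the queue (and the queue, if it becomes empty), on failure $\mathrm{Break}(dip)$. 3. For some $dip\notin vD(rt)$ with a queue of flag $\mathsf{req}$ in $store$: set this flag to $\mathsf{noReq}$; $sn:=inc(sn)$; $rreqid:=1+\max\{n\mid(ip,n)\in rreqs\}$ (with $\max\emptyset=0$); $rreqs:=rreqs\cup\{(ip,rreqid)\}$; broadcast $\mathrm{rreq}(0,rreqid,dip,sqn(rt,dip),sqnf(rt,dip),ip,sn,ip)$. **Networks.** A network expression $N$ consists of finitely many nodes with pairwise different addresses, each with a current state of its processes and a range $R_N^{ip}\subseteq\mathrm{IP}$. Write $\xi_N^{ip}(rt)$ for the routing table of node $ip$. In the transition $R:{*}\mathbf{cast}(m)$ performed by $ip$, the message $m$ is received by exactly the nodes other than $ip$ with address in $R$, where $R=R_N^{ip}$ for a broadcast, $R=R_N^{ip}\cap D$ for a groupcast to $D$, and $R=\{d\}$ for a unicast to $d\in R_N^{ip}$ (a unicast to $d\notin R_N^{ip}$ fails). The other transitions are silent steps of one node, deliveries of data to the client, the arrival of $\mathrm{newpkt}(data,dip)$ from the client at one node, and $\mathbf{connect}(ip,ip')$,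 $\mathbf{disconnect}(ip,ip')$, which add, respectively remove, $ip'$ to/from the range of $ip$ and $ip$ to/from the range of $ip'$ (at those of the two nodes that exist in the network). In an *initial* network every node $ip$ is about to execute $\mathrm{AODV}$ with $sn=1$, with $rt$, $rreqs$ and $store$ empty, and with an empty message queue, and the ranges are arbitrary up to symmetry: $ip'\in R^{ip}\Leftrightarrow ip\in R^{ip'}$ for all nodes $ip,ip'$ of the network. A *history* of $N$ is a finite sequence $H=N_0N_1\dots N_k$ with $N_k=N$, $N_0$ initial, and a transition from $N_{i-1}$ to $N_i$ for $1\le i\le k$. Its *connectivity graph* $\mathcal C_H$ is the directed graph whose vertices are the nodes of the network, with an arc from $ip$ to $ip'$ iff $ip'\in R_{N_i}^{ip}$ for some $0\le i\le k$. A *path* with $h$ hops from $ip$ to $ip'$ is a sequence of vertices $ip=v_0\to v_1\to\dots\to v_h=ip'$ of which consecutive ones are joined by an arc (vertices may repeat; a path with $0$ hops is a single vertex). **Theorem (route correctness).** Let $H$ be a history of a network state $N$. (a) For each routing table entry $(dip,*,*,*,hops,nhip,*)\in\xi_N^{ip}(rt)$ there is a path $ip\to nhip\to\dots\to dip$ in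 $\mathcal C_H$ from $ip$ to $dip$ with exactly $hops$ hops and (if $hops>0$) next hop $nhip$ (that is, $v_1=nhip$). (b) If in state $N$ some node $ip$ performs a transition $N\xrightarrow{R:{*}\mathbf{cast}(\mathrm{rreq}(hops_c,*,*,*,*,oip_c,*,ip_c))}N'$, then there is a path in $\mathcal C_H$ from $ip_c$ to $oip_c$ with exactly $hops_c$ hops. (c) If in state $N$ some node $ip$ performs a transition $N\xrightarrow{R:{*}\mathbf{cast}(\mathrm{rrep}(hops_c,dip_c,*,*,ip_c))}N'$, then there is a path in $\mathcal C_H$ from $ip_c$ to $dip_c$ with exactly $hops_c$ hops. -/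

import Mathlib

namespace AODV

/-! ### Data types -/

/-- Sequence-number-status flag: known or unknown. -/
inductive SQNK
  | kno
  | unk
deriving DecidableEq

/-- Validity of a route. -/
inductive RFlag
  | val
  | inval
deriving DecidableEq

/-- Request-required flag of a data queue: `req` says that a route request still has to be
initiated, `noReq` that this is not needed (any more). -/
inductive PFlag
  | noReq
  | req
deriving DecidableEq

/-- A routing table entry `(dip, dsn, dsk, flag, hops, nhip, pre)`; sequence numbers are natural
numbers, the number `0` standing for an unknown one. -/
structure Route (IP : Type) where
  dip : IP
  dsn : ℕ
  dsk : SQNK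
  flag : RFlag
  hops : ℕ
  nhip : IP
  pre : Set IP

/-- A routing table: a set of entries, different entries having different destinations. -/
structure RT (IP : Type) where
  entries : Set (Route IP)
  uniq : ∀ r ∈ entries, ∀ s ∈ entries, r ≠ s → r.dip ≠ s.dip

/-- Partial functions from addresses to sequence numbers (lists of unreachable destinations). -/
abbrev Dests (IP : Type) := IP → Option ℕ

/-- Stores of queued data packets: at most one pair (flag, queue) for every destination.
The head of a list is the oldest element of the queue. -/
abbrev Store (IP Data : Type) := IP → Option (PFlag × List Data)

/-- Messages. -/
inductive Msg (IP Data : Type)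
  /-- `rreq hops rreqid dip dsn dsk oip osn sip` -/
  | rreq (hops : ℕ) (rreqid : ℕ) (dip : IP) (dsn : ℕ) (dsk : SQNK) (oip : IP) (osn : ℕ) (sip : IP)
  /-- `rrep hops dip dsn oip sip` -/
  | rrep (hops : ℕ) (dip : IP) (dsn : ℕ) (oip : IP) (sip : IP)
  /-- `rerr dests sip` -/
  | rerr (dests : Dests IP) (sip : IP)
  /-- `newpkt data dip` -/
  | newpkt (data : Data) (dip : IP)
  /-- `pkt data dip sip` -/
  | pkt (data : Data) (dip : IP) (sip : IP)

/-! ### Functions on the data types -/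

section DataFunctions

variable {IP Data : Type}

/-- Increment a sequence number; the unknown number `0` stays `0`. -/
def inc (n : ℕ) : ℕ := if n = 0 then 0 else n + 1

/-- Add precursors to an entry. -/
def Route.addprec (r : Route IP) (npre : Set IP) : Route IP := { r with pre := r.pre ∪ npre }

namespace RT

/-- The empty routing table. -/
def empty : RT IP := ⟨∅, fun _ h => h.elim⟩

/-- Remove the entry (if any) for the destination of `r` and insert `r`. -/
def put (rt : RT IP) (r : Route IP) : RT IP where
  entries := {s | s ∈ rt.entries ∧ s.dip ≠ r.dip} ∪ {r}
  uniq := by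
    rintro a (⟨ha, ha'⟩ | rfl) b (⟨hb, hb'⟩ | rfl) hab
    · exact rt.uniq a ha b hb hab
    · exact ha'
    · exact fun h => hb' h.symm
    · exact absurd rfl hab

open Classical in
/-- The entry for destination `dip`, if there is one. -/
noncomputable def selr (rt : RT IP) (dip : IP) : Option (Route IP) :=
  if h : ∃ r, r ∈ rt.entries ∧ r.dip = dip then some h.choose else none

/-- Destination sequence number, `0` if there is no entry. -/
noncomputable def sqn (rt : RT IP) (dip : IP) : ℕ :=
  match rt.selr dip with
  | some r => r.dsn
  | none => 0

/-- Sequence-number-status flag, `unk` if there is no entry. -/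
noncomputable def sqnf (rt : RT IP) (dip : IP) : SQNK :=
  match rt.selr dip with
  | some r => r.dsk
  | none => SQNK.unk

/-- Hop count (partial). -/
noncomputable def dhops (rt : RT IP) (dip : IP) : Option ℕ := (rt.selr dip).map Route.hops

/-- Next hop (partial). -/
noncomputable def nhop (rt : RT IP) (dip : IP) : Option IP := (rt.selr dip).map Route.nhip

/-- Precursors (partial). -/
noncomputable def precs (rt : RT IP) (dip : IP) : Option (Set IP) := (rt.selr dip).map Route.pre

/-- Destinations of valid entries. -/
def vD (rt : RT IP) : Set IP := {dip | ∃ r ∈ rt.entries, r.dip = dip ∧ r.flag = RFlag.val}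

/-- Destinations of invalid entries. -/
def iD (rt : RT IP) : Set IP := {dip | ∃ r ∈ rt.entries, r.dip = dip ∧ r.flag = RFlag.inval}

/-- Add precursors to the entry for `dip` (undefined if there is no such entry). -/
noncomputable def addpreRT (rt : RT IP) (dip : IP) (npre : Set IP) : Option (RT IP) :=
  (rt.selr dip).map fun s => rt.put (s.addprec npre)

/-- The domain of `update`. -/
def Updatable (r : Route IP) : Prop :=
  r.flag = RFlag.val ∧ (r.dsn = 0 ↔ r.dsk = SQNK.unk) ∧ (r.dsk = SQNK.unk → r.hops = 1)

open Classical in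
/-- Update a routing table with new information `r` (a partial function). -/
noncomputable def update (rt : RT IP) (r : Route IP) : Option (RT IP) :=
  if Updatable r then
    match rt.selr r.dip with
    | none => some (rt.put r)
    | some s =>
      if s.dsn < r.dsn then some (rt.put (r.addprec s.pre))
      else if s.dsn = r.dsn ∧ r.hops < s.hops then some (rt.put (r.addprec s.pre))
      else if s.dsn = r.dsn ∧ s.flag = RFlag.inval then some (rt.put (r.addprec s.pre))
      else if r.dsk = SQNK.unk then some (rt.put { r.addprec s.pre with dsn := s.dsn })
      else some (rt.put (s.addprec r.pre))
  else none

/-- Invalidate the entries for all destinations listed in `dests`. -/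
def invalidate (rt : RT IP) (dests : Dests IP) : RT IP where
  entries := {r | r ∈ rt.entries ∧ dests r.dip = none} ∪
    {r' | ∃ r ∈ rt.entries, ∃ rsn, dests r.dip = some rsn ∧
      r' = { r with dsn := rsn, flag := RFlag.inval }}
  uniq := by
    rintro a (⟨ha, ha'⟩ | ⟨a, ha, n, ha', rfl⟩) b (⟨hb, hb'⟩ | ⟨b, hb, m, hb', rfl⟩) hab h
    · exact rt.uniq a ha b hb hab h
    · simp only at h
      rw [h, hb'] at ha'
      cases ha'
    · simp only at h
      rw [h, hb'] at ha'
      cases ha'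
    · simp only at h
      by_cases hh : a = b
      · subst hh
        rw [ha'] at hb'
        cases hb'
        exact hab rfl
      · exact rt.uniq a ha b hb hh h

open Classical in
/-- `{(rip, inc(sqn(rt,rip))) | rip ∈ vD(rt) ∧ nhop(rt,rip) = nhop(rt,d)}`; an equation with an
undefined side is false. -/
noncomputable def brokenVia (rt : RT IP) (d : IP) : Dests IP := fun rip =>
  if rip ∈ rt.vD ∧ ∃ h, rt.nhop rip = some h ∧ rt.nhop d = some h then some (inc (rt.sqn rip))
  else none

open Classical in
/-- `{(rip, rsn) ∈ dests | rip ∈ vD(rt) ∧ nhop(rt,rip) = sip ∧ sqn(rt,rip) < rsn}`. -/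
noncomputable def affected (rt : RT IP) (dests : Dests IP) (sip : IP) : Dests IP := fun rip =>
  match dests rip with
  | some rsn =>
    if rip ∈ rt.vD ∧ rt.nhop rip = some sip ∧ rt.sqn rip < rsn then some rsn else none
  | none => none

/-- `⋃ {precs(rt,rip) | (rip, *) ∈ dests}`. -/
def allPrecs (rt : RT IP) (dests : Dests IP) : Set IP :=
  {x | ∃ rip rsn s, dests rip = some rsn ∧ rt.precs rip = some s ∧ x ∈ s}

open Classical in
/-- `{(rip, rsn) ∈ dests | precs(rt,rip) ≠ ∅}`. -/
noncomputable def withPrecs (rt : RT IP) (dests : Dests IP) : Dests IP := fun rip =>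
  if ∃ s, rt.precs rip = some s ∧ s ≠ ∅ then dests rip else none

end RT

open Classical in
/-- The partial function with the single pair `(dip, n)`. -/
noncomputable def singleDest (dip : IP) (n : ℕ) : Dests IP :=
  fun x => if x = dip then some n else none

open Classical in
/-- A fresh route request identifier, `max {n | (ip, n) ∈ rreqs} + 1` with `max ∅ = 0`
(undefined if there is no maximum). -/
noncomputable def nrreqid (rreqs : Set (IP × ℕ)) (ip : IP) : Option ℕ :=
  if BddAbove {n | (ip, n) ∈ rreqs} then some (sSup {n | (ip, n) ∈ rreqs} + 1) else none

namespace Store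

/-- The empty store. -/
def empty : Store IP Data := fun _ => none

/-- The data queue for `dip`. -/
def selq (st : Store IP Data) (dip : IP) : List Data :=
  match st dip with
  | some (_, q) => q
  | none => []

/-- The destinations with unsent packets. -/
def qD (st : Store IP Data) : Set IP := {dip | (st dip).isSome}

/-- The request-required flag (partial). -/
def fD (st : Store IP Data) (dip : IP) : Option PFlag := (st dip).map Prod.fst

open Classical in
/-- Append a data packet to the queue for `dip`. -/
noncomputable def add (d : Data) (dip : IP) (st : Store IP Data) : Store IP Data :=
  match st dip with
  | none => Function.update st dip (some (PFlag.req, [d]))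
  | some (p, q) => Function.update st dip (some (p, q ++ [d]))

open Classical in
/-- Delete the oldest packet for `dip` (undefined if there is none). -/
noncomputable def drop (dip : IP) (st : Store IP Data) : Option (Store IP Data) :=
  match st dip with
  | none => none
  | some (_, []) => none
  | some (_, [_]) => some (Function.update st dip none)
  | some (p, _ :: d :: q) => some (Function.update st dip (some (p, d :: q)))

open Classical in
/-- Set the flag for `dip` to `noReq`. -/
noncomputable def unsetRRF (st : Store IP Data) (dip : IP) : Store IP Data :=
  match st dip with
  | none => st
  | some (_, q) => Function.update st dip (some (PFlag.noReq, q))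

/-- Set the flag to `req` for all destinations listed in `dests`. -/
def setRRF (st : Store IP Data) (dests : Dests IP) : Store IP Data := fun dip =>
  match dests dip with
  | none => st dip
  | some _ => (st dip).map fun pq => (PFlag.req, pq.2)

end Store

end DataFunctions

/-! ### Sequential processes: expressions -/

/-- Data variables. -/
inductive Var
  | ip | sn | rt | rreqs | store
  | msg | data | dip | oip | hops | rreqid | dsn | dsk | osn | sip | dests | pre
  | msgs
deriving DecidableEq

/-- The type of a data variable. -/
abbrev Ty (IP Data : Type) : Var → Type
  | .ip => IP
  | .sn => ℕ
  | .rt => RT IP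
  | .rreqs => Set (IP × ℕ)
  | .store => Store IP Data
  | .msg => Msg IP Data
  | .data => Data
  | .dip => IP
  | .oip => IP
  | .hops => ℕ
  | .rreqid => ℕ
  | .dsn => ℕ
  | .dsk => SQNK
  | .osn => ℕ
  | .sip => IP
  | .dests => Dests IP
  | .pre => Set IP
  | .msgs => List (Msg IP Data)

/-- Valuations: partial assignments of values to the data variables. -/
abbrev Val (IP Data : Type) := (v : Var) → Option (Ty IP Data v)

/-- Data expressions, given by their (possibly undefined) value under each valuation. -/
abbrev Exp (IP Data T : Type) := Val IP Data → Option T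

/-- Data formulas, given by their free variables and their truth under each valuation. -/
structure Formula (IP Data : Type) where
  fv : List Var
  holds : Val IP Data → Prop

/-- Names of the sequential processes. -/
inductive PName
  | aodv | newpkt | pkt | rreq | rrep | rerr | qmsg
deriving DecidableEq

/-- The parameters (formal arguments) of each process name. -/
def PName.params : PName → List Var
  | .aodv => [.ip, .sn, .rt, .rreqs, .store]
  | .newpkt => [.data, .dip, .ip, .sn, .rt, .rreqs, .store]
  | .pkt => [.data, .dip, .oip, .ip, .sn, .rt, .rreqs, .store]
  | .rreq =>
    [.hops, .rreqid, .dip, .dsn, .dsk, .oip, .osn, .sip, .ip, .sn, .rt, .rreqs, .store]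
  | .rrep => [.hops, .dip, .dsn, .oip, .sip, .ip, .sn, .rt, .rreqs, .store]
  | .rerr => [.dests, .sip, .ip, .sn, .rt, .rreqs, .store]
  | .qmsg => [.msgs]

/-- Sequential process expressions. In `call X args`, the expression `args v` is the actual
argument for the formal parameter `v` of `X`; its values at other `v` are irrelevant.
The variable bound by `receive` is `msg`, the only one that ranges over messages. -/
inductive SP (IP Data : Type) : Type
  | call (X : PName) (args : (v : Var) → Exp IP Data (Ty IP Data v))
  | guard (φ : Formula IP Data) (p : SP IP Data)
  | assign (v : Var) (e : Exp IP Data (Ty IP Data v)) (p : SP IP Data)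
  | choice (p q : SP IP Data)
  | broadcast (ms : Exp IP Data (Msg IP Data)) (p : SP IP Data)
  | groupcast (dests : Exp IP Data (Set IP)) (ms : Exp IP Data (Msg IP Data)) (p : SP IP Data)
  | unicast (dest : Exp IP Data IP) (ms : Exp IP Data (Msg IP Data)) (p q : SP IP Data)
  | send (ms : Exp IP Data (Msg IP Data)) (p : SP IP Data)
  | deliver (data : Exp IP Data Data) (p : SP IP Data)
  | receive (p : SP IP Data)

/-! ### Structural operational semantics -/

/-- Actions of sequential and parallel processes. -/
inductive Act (IP Data : Type)
  | broadcast (m : Msg IP Data)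
  | groupcast (D : Set IP) (m : Msg IP Data)
  | unicast (dip : IP) (m : Msg IP Data)
  | notUnicast (dip : IP) (m : Msg IP Data)
  | send (m : Msg IP Data)
  | deliver (d : Data)
  | receive (m : Msg IP Data)
  | tau

section Semantics

variable {IP Data : Type}

/-- `ζ` agrees with `ξ` where `ξ` is defined, is defined moreover on exactly the other free
variables of `φ`, and satisfies `φ`. -/
def Extends (ξ : Val IP Data) (φ : Formula IP Data) (ζ : Val IP Data) : Prop :=
  (∀ v, ξ v ≠ none → ζ v = ξ v) ∧
  (∀ v, ξ v = none → (ζ v ≠ none ↔ v ∈ φ.fv)) ∧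
  φ.holds ζ

/-- The valuation that assigns the values of the actual arguments to the parameters of `X`, and
nothing to other variables. -/
def callVal (X : PName) (args : (v : Var) → Exp IP Data (Ty IP Data v)) (ξ : Val IP Data) :
    Val IP Data :=
  fun v => if v ∈ X.params then args v ξ else none

/-- Transitions of sequential processes, relative to the defining equations `Γ`. -/
inductive SPStep (Γ : PName → SP IP Data) :
    Val IP Data → SP IP Data → Act IP Data → Val IP Data → SP IP Data → Prop
  | broadcast {ξ ms p m} : ms ξ = some m →
      SPStep Γ ξ (.broadcast ms p) (.broadcast m) ξ p
  | groupcast {ξ dests ms p D m} : dests ξ = some D → ms ξ = some m →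
      SPStep Γ ξ (.groupcast dests ms p) (.groupcast D m) ξ p
  | unicast {ξ dest ms p q d m} : dest ξ = some d → ms ξ = some m →
      SPStep Γ ξ (.unicast dest ms p q) (.unicast d m) ξ p
  | notUnicast {ξ dest ms p q d m} : dest ξ = some d → ms ξ = some m →
      SPStep Γ ξ (.unicast dest ms p q) (.notUnicast d m) ξ q
  | send {ξ ms p m} : ms ξ = some m →
      SPStep Γ ξ (.send ms p) (.send m) ξ p
  | deliver {ξ data p d} : data ξ = some d →
      SPStep Γ ξ (.deliver data p) (.deliver d) ξ p
  | receive {ξ p} (m : Msg IP Data) :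
      SPStep Γ ξ (.receive p) (.receive m) (Function.update ξ .msg (some m)) p
  | assign {ξ v e p x} : e ξ = some x →
      SPStep Γ ξ (.assign v e p) .tau (Function.update ξ v (some x)) p
  | call {ξ X args a ζ p'} : (∀ v ∈ X.params, args v ξ ≠ none) →
      SPStep Γ (callVal X args ξ) (Γ X) a ζ p' →
      SPStep Γ ξ (.call X args) a ζ p'
  | left {ξ p q a ζ p'} : SPStep Γ ξ p a ζ p' → SPStep Γ ξ (.choice p q) a ζ p'
  | right {ξ p q a ζ q'} : SPStep Γ ξ q a ζ q' → SPStep Γ ξ (.choice p q) a ζ q'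
  | guard {ξ φ p ζ} : Extends ξ φ ζ → SPStep Γ ξ (.guard φ p) .tau ζ p

/-- Parallel process expressions (running on one network node). -/
inductive PP (IP Data : Type) : Type
  | seq (ξ : Val IP Data) (p : SP IP Data)
  | par (P Q : PP IP Data)

/-- Transitions of parallel processes; messages flow from right to left. -/
inductive PPStep (Γ : PName → SP IP Data) : PP IP Data → Act IP Data → PP IP Data → Prop
  | seq {ξ p a ζ q} : SPStep Γ ξ p a ζ q → PPStep Γ (.seq ξ p) a (.seq ζ q)
  | left {P Q a P'} : PPStep Γ P a P' → (∀ m, a ≠ .receive m) →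
      PPStep Γ (.par P Q) a (.par P' Q)
  | right {P Q a Q'} : PPStep Γ Q a Q' → (∀ m, a ≠ .send m) →
      PPStep Γ (.par P Q) a (.par P Q')
  | sync {P Q P' Q' m} : PPStep Γ P (.receive m) P' → PPStep Γ Q (.send m) Q' →
      PPStep Γ (.par P Q) .tau (.par P' Q')

/-- Partial networks: parallel compositions of node expressions `ip : P : R`, where `R` is the
set of addresses within transmission range of `ip`. -/
inductive PNet (IP Data : Type) : Type
  | node (ip : IP) (P : PP IP Data) (R : Set IP)
  | par (M N : PNet IP Data)

/-- The node expressions of a partial network. -/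
def PNet.nodes : PNet IP Data → List (IP × PP IP Data × Set IP)
  | .node ip P R => [(ip, P, R)]
  | .par M N => M.nodes ++ N.nodes

/-- Transition labels of networks. `cast R m` is `R : *cast(m)`; `arrive H K m` says that the
message `m` arrives at the addresses in `H` and fails to arrive at those in `K`. -/
inductive Label (IP Data : Type)
  | cast (R : Set IP) (m : Msg IP Data)
  | arrive (H K : Set IP) (m : Msg IP Data)
  | connect (ip ip' : IP)
  | disconnect (ip ip' : IP)
  | newpkt (ip : IP) (d : Data) (dip : IP)
  | deliver (ip : IP) (d : Data)
  | tau

/-- Transitions of partial networks. -/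
inductive PNetStep (Γ : PName → SP IP Data) :
    PNet IP Data → Label IP Data → PNet IP Data → Prop
  | broadcast {ip P R m P'} : PPStep Γ P (.broadcast m) P' →
      PNetStep Γ (.node ip P R) (.cast R m) (.node ip P' R)
  | groupcast {ip P R D m P'} : PPStep Γ P (.groupcast D m) P' →
      PNetStep Γ (.node ip P R) (.cast (R ∩ D) m) (.node ip P' R)
  | unicast {ip P R d m P'} : PPStep Γ P (.unicast d m) P' → d ∈ R →
      PNetStep Γ (.node ip P R) (.cast {d} m) (.node ip P' R)
  | notUnicast {ip P R d m P'} : PPStep Γ P (.notUnicast d m) P' → d ∉ R →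
      PNetStep Γ (.node ip P R) .tau (.node ip P' R)
  | deliver {ip P R d P'} : PPStep Γ P (.deliver d) P' →
      PNetStep Γ (.node ip P R) (.deliver ip d) (.node ip P' R)
  | receive {ip P R m P'} : PPStep Γ P (.receive m) P' →
      PNetStep Γ (.node ip P R) (.arrive {ip} ∅ m) (.node ip P' R)
  | tau {ip P R P'} : PPStep Γ P .tau P' →
      PNetStep Γ (.node ip P R) .tau (.node ip P' R)
  | disregard {ip P R m} :
      PNetStep Γ (.node ip P R) (.arrive ∅ {ip} m) (.node ip P R)
  | connect {ip P R ip'} :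
      PNetStep Γ (.node ip P R) (.connect ip ip') (.node ip P (R ∪ {ip'}))
  | disconnect {ip P R ip'} :
      PNetStep Γ (.node ip P R) (.disconnect ip ip') (.node ip P (R \ {ip'}))
  | connect' {ip P R ip'} :
      PNetStep Γ (.node ip P R) (.connect ip' ip) (.node ip P (R ∪ {ip'}))
  | disconnect' {ip P R ip'} :
      PNetStep Γ (.node ip P R) (.disconnect ip' ip) (.node ip P (R \ {ip'}))
  | connectOther {ip P R ip' ip''} : ip ≠ ip' → ip ≠ ip'' →
      PNetStep Γ (.node ip P R) (.connect ip' ip'') (.node ip P R)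
  | disconnectOther {ip P R ip' ip''} : ip ≠ ip' → ip ≠ ip'' →
      PNetStep Γ (.node ip P R) (.disconnect ip' ip'') (.node ip P R)
  | castLeft {M N M' N' R H K m} : PNetStep Γ M (.cast R m) M' →
      PNetStep Γ N (.arrive H K m) N' → H ⊆ R → K ∩ R = ∅ →
      PNetStep Γ (.par M N) (.cast R m) (.par M' N')
  | castRight {M N M' N' R H K m} : PNetStep Γ M (.arrive H K m) M' →
      PNetStep Γ N (.cast R m) N' → H ⊆ R → K ∩ R = ∅ →
      PNetStep Γ (.par M N) (.cast R m) (.par M' N')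
  | arrive {M N M' N' H K H' K' m} : PNetStep Γ M (.arrive H K m) M' →
      PNetStep Γ N (.arrive H' K' m) N' →
      PNetStep Γ (.par M N) (.arrive (H ∪ H') (K ∪ K') m) (.par M' N')
  | deliverLeft {M N M' ip d} : PNetStep Γ M (.deliver ip d) M' →
      PNetStep Γ (.par M N) (.deliver ip d) (.par M' N)
  | deliverRight {M N N' ip d} : PNetStep Γ N (.deliver ip d) N' →
      PNetStep Γ (.par M N) (.deliver ip d) (.par M N')
  | tauLeft {M N M'} : PNetStep Γ M .tau M' → PNetStep Γ (.par M N) .tau (.par M' N)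
  | tauRight {M N N'} : PNetStep Γ N .tau N' → PNetStep Γ (.par M N) .tau (.par M N')
  | connectPar {M N M' N' ip ip'} : PNetStep Γ M (.connect ip ip') M' →
      PNetStep Γ N (.connect ip ip') N' →
      PNetStep Γ (.par M N) (.connect ip ip') (.par M' N')
  | disconnectPar {M N M' N' ip ip'} : PNetStep Γ M (.disconnect ip ip') M' →
      PNetStep Γ N (.disconnect ip ip') N' →
      PNetStep Γ (.par M N) (.disconnect ip ip') (.par M' N')

/-- `CastBy Γ ip R m M M'`: the partial network `M` has a transition `R : *cast(m)` to `M'` in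
which the cast action is performed by the node `ip`. -/
inductive CastBy (Γ : PName → SP IP Data) (ip : IP) (R : Set IP) (m : Msg IP Data) :
    PNet IP Data → PNet IP Data → Prop
  | node {P P' R₀} : PNetStep Γ (.node ip P R₀) (.cast R m) (.node ip P' R₀) →
      CastBy Γ ip R m (.node ip P R₀) (.node ip P' R₀)
  | left {M N M' N' H K} : CastBy Γ ip R m M M' →
      PNetStep Γ N (.arrive H K m) N' → H ⊆ R → K ∩ R = ∅ →
      CastBy Γ ip R m (.par M N) (.par M' N')
  | right {M N M' N' H K} : PNetStep Γ M (.arrive H K m) M' →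
      CastBy Γ ip R m N N' → H ⊆ R → K ∩ R = ∅ →
      CastBy Γ ip R m (.par M N) (.par M' N')

/-- (Complete) network expressions: encapsulated partial networks. -/
inductive Net (IP Data : Type) : Type
  | encap (M : PNet IP Data)

/-- The node expressions of a network. -/
def Net.nodes : Net IP Data → List (IP × PP IP Data × Set IP)
  | .encap M => M.nodes

/-- Transitions of networks. -/
inductive NetStep (Γ : PName → SP IP Data) : Net IP Data → Label IP Data → Net IP Data → Prop
  | connect {M M' ip ip'} : PNetStep Γ M (.connect ip ip') M' →
      NetStep Γ (.encap M) (.connect ip ip') (.encap M')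
  | disconnect {M M' ip ip'} : PNetStep Γ M (.disconnect ip ip') M' →
      NetStep Γ (.encap M) (.disconnect ip ip') (.encap M')
  | cast {M M' R m} : PNetStep Γ M (.cast R m) M' → NetStep Γ (.encap M) .tau (.encap M')
  | tau {M M'} : PNetStep Γ M .tau M' → NetStep Γ (.encap M) .tau (.encap M')
  | deliver {M M' ip d} : PNetStep Γ M (.deliver ip d) M' →
      NetStep Γ (.encap M) (.deliver ip d) (.encap M')
  | newpkt {M M' ip K d dip} : PNetStep Γ M (.arrive {ip} K (.newpkt d dip)) M' →
      NetStep Γ (.encap M) (.newpkt ip d dip) (.encap M')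

/-- The network transition from `N` to `N'` stems from a transition `R : *cast(m)` of the
encapsulated partial network in which the cast is performed by node `ip`. -/
inductive NetCastBy (Γ : PName → SP IP Data) (ip : IP) (R : Set IP) (m : Msg IP Data) :
    Net IP Data → Net IP Data → Prop
  | encap {M M'} : CastBy Γ ip R m M M' → NetCastBy Γ ip R m (.encap M) (.encap M')

end Semantics

/-! ### The AODV specification -/

section Spec

variable {IP Data : Type}

/-- Call of a process with each parameter as the actual argument for itself. -/
def SP.callSame (X : PName) : SP IP Data := .call X fun v ξ => ξ v

/-- `AODV(ip, sn, rt, rreqs, store)`. -/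
abbrev SP.main : SP IP Data := .callSame .aodv

/-- `[e₁ = e₂]`, false if a side is undefined. -/
def Formula.eq {T : Type} (fv : List Var) (e₁ e₂ : Exp IP Data T) : Formula IP Data :=
  ⟨fv, fun ξ => ∃ x, e₁ ξ = some x ∧ e₂ ξ = some x⟩

/-- `[e₁ ≠ e₂]`, false if a side is undefined. -/
def Formula.ne {T : Type} (fv : List Var) (e₁ e₂ : Exp IP Data T) : Formula IP Data :=
  ⟨fv, fun ξ => ∃ x y, e₁ ξ = some x ∧ e₂ ξ = some y ∧ x ≠ y⟩

/-- The new entry `(sip, 0, unk, val, 1, sip, ∅)` for the sender of a message. -/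
def senderRoute (sip : IP) : Route IP := ⟨sip, 0, .unk, .val, 1, sip, ∅⟩

/-- `[[rt := update(rt, (sip, 0, unk, val, 1, sip, ∅))]] p`. -/
noncomputable def SP.updateSender (p : SP IP Data) : SP IP Data :=
  .assign .rt (fun ξ => do (← ξ .rt).update (senderRoute (← ξ .sip))) p

/-- The actions common to all error handling, after `dests` has been determined:
```
[[rt := invalidate(rt, dests)]] [[store := setRRF(store, dests)]]
[[pre := ⋃{precs(rt,rip) | (rip,*) ∈ dests}]]
[[dests := {(rip,rsn) | (rip,rsn) ∈ dests ∧ precs(rt,rip) ≠ ∅}]]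
groupcast(pre, rerr(dests, ip)) . AODV(ip, sn, rt, rreqs, store)
``` -/
noncomputable def SP.sendError : SP IP Data :=
  .assign .rt (fun ξ => do return (← ξ .rt).invalidate (← ξ .dests)) <|
  .assign .store (fun ξ => do return (← ξ .store).setRRF (← ξ .dests)) <|
  .assign .pre (fun ξ => do return (← ξ .rt).allPrecs (← ξ .dests)) <|
  .assign .dests (fun ξ => do return (← ξ .rt).withPrecs (← ξ .dests)) <|
  .groupcast (fun ξ => ξ .pre) (fun ξ => do return .rerr (← ξ .dests) (← ξ .ip)) <|
  .main

/-- The continuation after a failed unicast to the next hop on the route to `dst`: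
`[[dests := {(rip, inc(sqn(rt,rip))) | rip ∈ vD(rt) ∧ nhop(rt,rip) = nhop(rt,dst)}]]` followed
by the common error handling. -/
noncomputable def SP.linkBreak (dst : Exp IP Data IP) : SP IP Data :=
  .assign .dests (fun ξ => do return (← ξ .rt).brokenVia (← dst ξ)) .sendError

/-- The basic routine `AODV(ip, sn, rt, rreqs, store)`. -/
noncomputable def aodvBody : SP IP Data :=
  .choice
    -- handle a message
    (.receive <|
      .choice
        -- msg = newpkt(data, dip)
        (.guard (.eq [.msg, .data, .dip] (fun ξ => ξ .msg)
            (fun ξ => do return .newpkt (← ξ .data) (← ξ .dip))) <|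
          .callSame .newpkt) <|
      .choice
        -- msg = pkt(data, dip, oip)
        (.guard (.eq [.msg, .data, .dip, .oip] (fun ξ => ξ .msg)
            (fun ξ => do return .pkt (← ξ .data) (← ξ .dip) (← ξ .oip))) <|
          .callSame .pkt) <|
      .choice
        -- msg = rreq(hops, rreqid, dip, dsn, dsk, oip, osn, sip)
        (.guard (.eq [.msg, .hops, .rreqid, .dip, .dsn, .dsk, .oip, .osn, .sip] (fun ξ => ξ .msg)
            (fun ξ => do
              return .rreq (← ξ .hops) (← ξ .rreqid) (← ξ .dip) (← ξ .dsn) (← ξ .dsk)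
                (← ξ .oip) (← ξ .osn) (← ξ .sip))) <|
          .updateSender <| .callSame .rreq) <|
      .choice
        -- msg = rrep(hops, dip, dsn, oip, sip)
        (.guard (.eq [.msg, .hops, .dip, .dsn, .oip, .sip] (fun ξ => ξ .msg)
            (fun ξ => do return .rrep (← ξ .hops) (← ξ .dip) (← ξ .dsn) (← ξ .oip) (← ξ .sip))) <|
          .updateSender <| .callSame .rrep)
        -- msg = rerr(dests, sip)
        (.guard (.eq [.msg, .dests, .sip] (fun ξ => ξ .msg)
            (fun ξ => do return .rerr (← ξ .dests) (← ξ .sip))) <|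
          .updateSender <| .callSame .rerr)) <|
  .choice
    -- send a queued data packet, for some dip ∈ qD(store) ∩ vD(rt)
    (.guard ⟨[.dip, .store, .rt], fun ξ => ∃ dip st rt, ξ .dip = some dip ∧ ξ .store = some st ∧
        ξ .rt = some rt ∧ dip ∈ Store.qD st ∩ rt.vD⟩ <|
      .assign .data (fun ξ => do (Store.selq (← ξ .store) (← ξ .dip)).head?) <|
      .unicast (fun ξ => do (← ξ .rt).nhop (← ξ .dip))
        (fun ξ => do return .pkt (← ξ .data) (← ξ .dip) (← ξ .ip))
        (.assign .store (fun ξ => do Store.drop (← ξ .dip) (← ξ .store)) .main)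
        (.linkBreak fun ξ => ξ .dip))
    -- initiate a route discovery, for some dip ∈ qD(store) − vD(rt) whose flag is req
    (.guard ⟨[.dip, .store, .rt], fun ξ => ∃ dip st rt, ξ .dip = some dip ∧ ξ .store = some st ∧
        ξ .rt = some rt ∧ dip ∈ Store.qD st \ rt.vD ∧ Store.fD st dip = some .req⟩ <|
      .assign .store (fun ξ => do return Store.unsetRRF (← ξ .store) (← ξ .dip)) <|
      .assign .sn (fun ξ => do return inc (← ξ .sn)) <|
      .assign .rreqid (fun ξ => do nrreqid (← ξ .rreqs) (← ξ .ip)) <|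
      .assign .rreqs (fun ξ => do return (← ξ .rreqs) ∪ {((← ξ .ip), (← ξ .rreqid))}) <|
      .broadcast (fun ξ => do
        let rt ← ξ .rt
        let dip ← ξ .dip
        return .rreq 0 (← ξ .rreqid) dip (rt.sqn dip) (rt.sqnf dip) (← ξ .ip) (← ξ .sn) (← ξ .ip))
      .main)

/-- Handling a newly injected data packet: `NEWPKT(data, dip, ip, sn, rt, rreqs, store)`. -/
noncomputable def newpktBody : SP IP Data :=
  .choice
    (.guard (.eq [.dip, .ip] (fun ξ => ξ .dip) (fun ξ => ξ .ip)) <|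
      .deliver (fun ξ => ξ .data) .main)
    (.guard (.ne [.dip, .ip] (fun ξ => ξ .dip) (fun ξ => ξ .ip)) <|
      .assign .store (fun ξ => do return Store.add (← ξ .data) (← ξ .dip) (← ξ .store)) .main)

/-- Handling a received data packet: `PKT(data, dip, oip, ip, sn, rt, rreqs, store)`. -/
noncomputable def pktBody : SP IP Data :=
  .choice
    (.guard (.eq [.dip, .ip] (fun ξ => ξ .dip) (fun ξ => ξ .ip)) <|
      .deliver (fun ξ => ξ .data) .main)
    (.guard (.ne [.dip, .ip] (fun ξ => ξ .dip) (fun ξ => ξ .ip)) <|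
      .choice
        (.guard ⟨[.dip, .rt], fun ξ => ∃ dip rt, ξ .dip = some dip ∧ ξ .rt = some rt ∧
            dip ∈ rt.vD⟩ <|
          .unicast (fun ξ => do (← ξ .rt).nhop (← ξ .dip))
            (fun ξ => do return .pkt (← ξ .data) (← ξ .dip) (← ξ .oip))
            .main
            (.linkBreak fun ξ => ξ .dip))
        (.guard ⟨[.dip, .rt], fun ξ => ∃ dip rt, ξ .dip = some dip ∧ ξ .rt = some rt ∧
            dip ∉ rt.vD⟩ <|
          .choice
            (.guard ⟨[.dip, .rt], fun ξ => ∃ dip rt, ξ .dip = some dip ∧ ξ .rt = some rt ∧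
                dip ∈ rt.iD⟩ <|
              .groupcast (fun ξ => do (← ξ .rt).precs (← ξ .dip))
                (fun ξ => do
                  let rt ← ξ .rt
                  let dip ← ξ .dip
                  return .rerr (singleDest dip (rt.sqn dip)) (← ξ .ip))
                .main)
            (.guard ⟨[.dip, .rt], fun ξ => ∃ dip rt, ξ .dip = some dip ∧ ξ .rt = some rt ∧
                dip ∉ rt.iD⟩
              .main)))

/-- Handling a route request:
`RREQ(hops, rreqid, dip, dsn, dsk, oip, osn, sip, ip, sn, rt, rreqs, store)`. -/
noncomputable def rreqBody : SP IP Data :=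
  .choice
    (.guard ⟨[.oip, .rreqid, .rreqs], fun ξ => ∃ oip id rs, ξ .oip = some oip ∧
        ξ .rreqid = some id ∧ ξ .rreqs = some rs ∧ (oip, id) ∈ rs⟩
      .main)
    (.guard ⟨[.oip, .rreqid, .rreqs], fun ξ => ∃ oip id rs, ξ .oip = some oip ∧
        ξ .rreqid = some id ∧ ξ .rreqs = some rs ∧ (oip, id) ∉ rs⟩ <|
      -- rt := update(rt, (oip, osn, kno, val, hops + 1, sip, ∅))
      .assign .rt (fun ξ => do
        (← ξ .rt).update ⟨← ξ .oip, ← ξ .osn, .kno, .val, (← ξ .hops) + 1, ← ξ .sip, ∅⟩) <|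
      .assign .rreqs (fun ξ => do return (← ξ .rreqs) ∪ {((← ξ .oip), (← ξ .rreqid))}) <|
      .choice
        -- this node is the destination
        (.guard (.eq [.dip, .ip] (fun ξ => ξ .dip) (fun ξ => ξ .ip)) <|
          .assign .sn (fun ξ => do return max (← ξ .sn) (← ξ .dsn)) <|
          .unicast (fun ξ => do (← ξ .rt).nhop (← ξ .oip))
            (fun ξ => do return .rrep 0 (← ξ .dip) (← ξ .sn) (← ξ .oip) (← ξ .ip))
            .main
            (.linkBreak fun ξ => ξ .oip))
        (.guard (.ne [.dip, .ip] (fun ξ => ξ .dip) (fun ξ => ξ .ip)) <|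
          .choice
            -- a valid and fresh enough route to dip is known
            (.guard ⟨[.dip, .rt, .dsn], fun ξ => ∃ dip rt dsn, ξ .dip = some dip ∧
                ξ .rt = some rt ∧ ξ .dsn = some dsn ∧
                dip ∈ rt.vD ∧ dsn ≤ rt.sqn dip ∧ rt.sqnf dip = .kno⟩ <|
              .assign .rt (fun ξ => do (← ξ .rt).addpreRT (← ξ .dip) {(← ξ .sip)}) <|
              .assign .rt (fun ξ => do
                let rt ← ξ .rt
                rt.addpreRT (← ξ .oip) {(← rt.nhop (← ξ .dip))}) <|
              .unicast (fun ξ => do (← ξ .rt).nhop (← ξ .oip))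
                (fun ξ => do
                  let rt ← ξ .rt
                  let dip ← ξ .dip
                  return .rrep (← rt.dhops dip) dip (rt.sqn dip) (← ξ .oip) (← ξ .ip))
                .main
                (.linkBreak fun ξ => ξ .oip))
            -- otherwise forward the request
            (.guard ⟨[.dip, .rt, .dsn], fun ξ => ∃ dip rt dsn, ξ .dip = some dip ∧
                ξ .rt = some rt ∧ ξ .dsn = some dsn ∧
                (dip ∉ rt.vD ∨ rt.sqn dip < dsn ∨ rt.sqnf dip = .unk)⟩ <|
              .broadcast (fun ξ => do
                let rt ← ξ .rt
                let dip ← ξ .dip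
                return .rreq ((← ξ .hops) + 1) (← ξ .rreqid) dip (max (rt.sqn dip) (← ξ .dsn))
                  (← ξ .dsk) (← ξ .oip) (← ξ .osn) (← ξ .ip))
              .main)))

/-- `update(rt, (dip, dsn, kno, val, hops + 1, sip, ∅))`. -/
noncomputable def replyUpdate : Exp IP Data (RT IP) := fun ξ => do
  (← ξ .rt).update ⟨← ξ .dip, ← ξ .dsn, .kno, .val, (← ξ .hops) + 1, ← ξ .sip, ∅⟩

/-- Handling a route reply: `RREP(hops, dip, dsn, oip, sip, ip, sn, rt, rreqs, store)`. -/
noncomputable def rrepBody : SP IP Data :=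
  .choice
    (.guard (.ne [.rt, .dip, .dsn, .hops, .sip] (fun ξ => ξ .rt) replyUpdate) <|
      .assign .rt replyUpdate <|
      .choice
        (.guard (.eq [.oip, .ip] (fun ξ => ξ .oip) (fun ξ => ξ .ip)) .main)
        (.guard (.ne [.oip, .ip] (fun ξ => ξ .oip) (fun ξ => ξ .ip)) <|
          .choice
            (.guard ⟨[.oip, .rt], fun ξ => ∃ oip rt, ξ .oip = some oip ∧ ξ .rt = some rt ∧
                oip ∈ rt.vD⟩ <|
              .assign .rt (fun ξ => do
                let rt ← ξ .rt
                rt.addpreRT (← ξ .dip) {(← rt.nhop (← ξ .oip))}) <|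
              .assign .rt (fun ξ => do
                let rt ← ξ .rt
                rt.addpreRT (← rt.nhop (← ξ .dip)) {(← rt.nhop (← ξ .oip))}) <|
              .unicast (fun ξ => do (← ξ .rt).nhop (← ξ .oip))
                (fun ξ => do
                  return .rrep ((← ξ .hops) + 1) (← ξ .dip) (← ξ .dsn) (← ξ .oip) (← ξ .ip))
                .main
                (.linkBreak fun ξ => ξ .oip))
            (.guard ⟨[.oip, .rt], fun ξ => ∃ oip rt, ξ .oip = some oip ∧ ξ .rt = some rt ∧
                oip ∉ rt.vD⟩
              .main)))
    (.guard (.eq [.rt, .dip, .dsn, .hops, .sip] (fun ξ => ξ .rt) replyUpdate) .main)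

/-- Handling a route error: `RERR(dests, sip, ip, sn, rt, rreqs, store)`. -/
noncomputable def rerrBody : SP IP Data :=
  .assign .dests (fun ξ => do return (← ξ .rt).affected (← ξ .dests) (← ξ .sip)) .sendError

/-- `receive(msg) . QMSG(append(msg, msgs))`. -/
def storeMsg : SP IP Data :=
  .receive <| .call .qmsg <| Function.update (fun v ξ => ξ v) .msgs
    (fun ξ => do return (← ξ .msgs) ++ [← ξ .msg])

/-- The message queue `QMSG(msgs)`. -/
def qmsgBody : SP IP Data :=
  .choice storeMsg
    (.guard (.ne [.msgs] (fun ξ => ξ .msgs) (fun _ => some [])) <|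
      .choice
        (.send (fun ξ => do (← ξ .msgs).head?) <|
          .call .qmsg <| Function.update (fun v ξ => ξ v) .msgs
            (fun ξ => do (← ξ .msgs).tail?))
        storeMsg)

/-- The defining equations. -/
noncomputable def spec : PName → SP IP Data
  | .aodv => aodvBody
  | .newpkt => newpktBody
  | .pkt => pktBody
  | .rreq => rreqBody
  | .rrep => rrepBody
  | .rerr => rerrBody
  | .qmsg => qmsgBody

/-- The initial parallel process
`(ξ, AODV(ip, sn, rt, rreqs, store)) ⟪ (ζ, QMSG(msgs))` of a node with address `ip`. -/
def InitialPP (ip : IP) (P : PP IP Data) : Prop :=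
  ∃ ξ ζ : Val IP Data, P = .par (.seq ξ .main) (.seq ζ (.callSame .qmsg)) ∧
    ξ .ip = some ip ∧ ξ .sn = some 1 ∧ ξ .rt = some RT.empty ∧ ξ .rreqs = some ∅ ∧
    ξ .store = some Store.empty ∧ ζ .msgs = some []

/-- Initial network expressions: finitely many nodes with pairwise different addresses, all in
the initial state; the ranges are arbitrary, except that two nodes of the network are
connected either in both directions or not at all. -/
def Initial (N : Net IP Data) : Prop :=
  (N.nodes.map Prod.fst).Nodup ∧
  (∀ n ∈ N.nodes, InitialPP n.1 n.2.1) ∧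
  (∀ n ∈ N.nodes, ∀ n' ∈ N.nodes, n'.1 ∈ n.2.2 ↔ n.1 ∈ n'.2.2)

/-! ### Histories, connectivity graphs and paths -/

/-- `IsHistory H N`: the list `H = N₀ N₁ … N_k` is a history of the state `N = N_k`. -/
inductive IsHistory : List (Net IP Data) → Net IP Data → Prop
  | init {N} : Initial N → IsHistory [N] N
  | step {H N ℓ N'} : IsHistory H N → NetStep spec N ℓ N' → IsHistory (H ++ [N']) N'

/-- The addresses of the nodes of a network. -/
def Net.addrs (N : Net IP Data) : Set IP := {ip | ∃ P R, (ip, P, R) ∈ N.nodes}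

/-- Node `ip'` is in the range of node `ip` in the network `N`. -/
def Net.InRange (N : Net IP Data) (ip ip' : IP) : Prop :=
  ∃ P R, (ip, P, R) ∈ N.nodes ∧ ip' ∈ R

/-- `N.HasRT ip rt`: in the network `N`, node `ip` has routing table `rt`, that is, `N` has a node
expression `ip : (ξ, p ⟪ ζ, q) : R` with `ξ(rt) = rt`. -/
def Net.HasRT (N : Net IP Data) (ip : IP) (rt : RT IP) : Prop :=
  ∃ ξ p ζ q R, (ip, PP.par (.seq ξ p) (.seq ζ q), R) ∈ N.nodes ∧ ξ .rt = some rt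

/-- The vertices of the connectivity graph of a history: the nodes of the network. -/
def Vertex (H : List (Net IP Data)) (ip : IP) : Prop := ∃ N ∈ H, ip ∈ N.addrs

/-- The arcs of the connectivity graph of a history. -/
def Arc (H : List (Net IP Data)) (ip ip' : IP) : Prop :=
  Vertex H ip ∧ Vertex H ip' ∧ ∃ N ∈ H, N.InRange ip ip'

/-- `f 0 → f 1 → … → f hops` is a path with `hops` hops in the connectivity graph of `H`, from
`ip` to `dip`. -/
def IsPath (H : List (Net IP Data)) (f : ℕ → IP) (hops : ℕ) (ip dip : IP) : Prop :=
  f 0 = ip ∧ f hops = dip ∧ (∀ i ≤ hops, Vertex H (f i)) ∧ ∀ i < hops, Arc H (f i) (f (i + 1))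

end Spec

end AODV

/-!
Fix a history `H`. Paths of its connectivity graph are built backwards, one arc at a time: if a
node `ip` gets a message from `sip` that claims a route with `n` hops from `sip` to some
destination, then `ip` is or was in the range of `sip`; ranges are symmetric
(`PNetStep.rangesSymmetric`), so there is an arc from `ip` to `sip`, and the entry with `n + 1` hops
and next hop `sip` that `ip` makes out of the message describes a path. No other operation on
routing tables changes the destination, hop count or next hop of an entry, and the messages a node
casts claim a route that it has just learnt from a message, one in its table, or the path without
hops from the node to itself.

To turn this into an induction over transitions, every process expression is given a verification
condition `SP.Sat` by structural recursion. It is relative to a `Contract`, which states an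
invariant of valuations, the messages that may be received, cast and sent, and a precondition for
each process name. If the body of each process name satisfies its condition under its precondition,
then steps preserve `SP.Sat` (`SPStep.sat`). Two contracts are used on each node: `aodvContract`
for the routing process (`spec_sat_aodvContract`) and `queueContract` for the message queue, through
which the soundness of messages is passed on (`spec_sat_queueContract`).

The graph is that of the whole history `H` while the induction (`IsHistory.sound`) runs over the
histories contained in `H`. Thus the graph does not change in the course of the induction, and
nothing has to be shown about the growth of the connectivity graph.
-/

namespace AODV

variable {IP Data : Type}

/-! ### Paths in the connectivity graph -/

/-- There is a path with `n` hops from `a` to `b` in the connectivity graph of `H`. -/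
def HasPath (H : List (Net IP Data)) (n : ℕ) (a b : IP) : Prop := ∃ f : ℕ → IP, IsPath H f n a b

theorem HasPath.zero {H : List (Net IP Data)} {a : IP} (h : Vertex H a) : HasPath H 0 a a :=
  ⟨fun _ => a, rfl, rfl, fun _ _ => h, fun _ hi => absurd hi (Nat.not_lt_zero _)⟩

/-- The entry `r` of a routing table of node `ip` describes a path in the connectivity graph
of `H`. -/
def RouteSound (H : List (Net IP Data)) (ip : IP) (r : Route IP) : Prop :=
  ∃ f : ℕ → IP, IsPath H f r.hops ip r.dip ∧ (0 < r.hops → f 1 = r.nhip)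

theorem RouteSound.hasPath {H : List (Net IP Data)} {ip : IP} {r : Route IP}
    (h : RouteSound H ip r) : HasPath H r.hops ip r.dip :=
  h.imp fun _ => And.left

theorem RouteSound.congr {H : List (Net IP Data)} {ip : IP} {r s : Route IP}
    (h : RouteSound H ip r) (h₁ : s.dip = r.dip) (h₂ : s.hops = r.hops) (h₃ : s.nhip = r.nhip) :
    RouteSound H ip s := by
  rw [RouteSound, h₁, h₂, h₃]
  exact h

/-- A route learnt from a neighbour: prepend the arc to the neighbour to its path. -/
theorem HasPath.routeSound {H : List (Net IP Data)} {n : ℕ} {ip sip dip : IP}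
    (h : HasPath H n sip dip) (ha : Arc H ip sip) (dsn : ℕ) (dsk : SQNK) (flag : RFlag)
    (pre : Set IP) : RouteSound H ip ⟨dip, dsn, dsk, flag, n + 1, sip, pre⟩ := by
  obtain ⟨f, h0, hn, hv, hf⟩ := h
  refine ⟨fun i => Nat.casesOn i ip f, ⟨rfl, hn, ?_, ?_⟩, fun _ => h0⟩
  · rintro (_ | i) hi
    · exact ha.1
    · exact hv i (Nat.le_of_succ_le_succ hi)
  · rintro (_ | i) hi
    · exact (congrArg (Arc H ip) h0).mpr ha
    · exact hf i (Nat.lt_of_succ_lt_succ hi)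

theorem HasPath.cons {H : List (Net IP Data)} {n : ℕ} {ip sip dip : IP}
    (h : HasPath H n sip dip) (ha : Arc H ip sip) : HasPath H (n + 1) ip dip :=
  (h.routeSound ha 0 .unk .val ∅).hasPath

theorem Arc.routeSound_senderRoute {H : List (Net IP Data)} {ip sip : IP} (ha : Arc H ip sip) :
    RouteSound H ip (senderRoute sip) :=
  (HasPath.zero ha.2.1).routeSound ha _ _ _ _

/-! ### Routing tables -/

/-- All entries of a routing table of node `ip` describe paths. -/
def RTSound (H : List (Net IP Data)) (ip : IP) (rt : RT IP) : Prop :=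
  ∀ r ∈ rt.entries, RouteSound H ip r

theorem RT.mem_of_selr {rt : RT IP} {dip : IP} {r : Route IP} (h : rt.selr dip = some r) :
    r ∈ rt.entries ∧ r.dip = dip := by
  unfold RT.selr at h
  split at h
  case isTrue h' => cases h; exact h'.choose_spec
  case isFalse => cases h

namespace RTSound

variable {H : List (Net IP Data)} {ip : IP} {rt rt' : RT IP}

theorem empty : RTSound H ip RT.empty := fun _ h => h.elim

theorem put (h : RTSound H ip rt) {r : Route IP} (hr : RouteSound H ip r) :
    RTSound H ip (rt.put r) := by
  rintro s (⟨hs, -⟩ | rfl)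
  · exact h s hs
  · exact hr

theorem update (h : RTSound H ip rt) {r : Route IP} (hr : RouteSound H ip r)
    (hu : rt.update r = some rt') : RTSound H ip rt' := by
  unfold RT.update at hu
  split at hu
  case isFalse => cases hu
  split at hu
  · cases hu
    exact h.put hr
  next s hs =>
    have hs := h s (RT.mem_of_selr hs).1
    split_ifs at hu <;> cases hu
    · exact h.put (hr.congr rfl rfl rfl)
    · exact h.put (hr.congr rfl rfl rfl)
    · exact h.put (hr.congr rfl rfl rfl)
    · exact h.put (hr.congr rfl rfl rfl)
    · exact h.put (hs.congr rfl rfl rfl)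

theorem addpreRT (h : RTSound H ip rt) {dip : IP} {npre : Set IP}
    (hu : rt.addpreRT dip npre = some rt') : RTSound H ip rt' := by
  obtain ⟨s, hs, rfl⟩ := Option.map_eq_some_iff.1 hu
  exact h.put ((h s (RT.mem_of_selr hs).1).congr rfl rfl rfl)

theorem invalidate (h : RTSound H ip rt) (dests : Dests IP) :
    RTSound H ip (rt.invalidate dests) := by
  rintro s (⟨hs, -⟩ | ⟨r, hr, n, -, rfl⟩)
  · exact h s hs
  · exact (h r hr).congr rfl rfl rfl

theorem hasPath_of_dhops (h : RTSound H ip rt) {dip : IP} {n : ℕ} (hn : rt.dhops dip = some n) :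
    HasPath H n ip dip := by
  obtain ⟨s, hs, rfl⟩ := Option.map_eq_some_iff.1 hn
  obtain ⟨hmem, rfl⟩ := RT.mem_of_selr hs
  exact (h s hmem).hasPath

end RTSound

/-! ### Messages -/

/-- The sender of `m` satisfies `S`, and if `m` is a route request or a route reply, its hop count
is that of a path from the sender to the originator, respectively the destination, of the route.
A message is sound when cast by `ip` with `S := (· = ip)`, and when received by `ip` with
`S := Arc H ip`. Data packets carry no sender, so they are always sound. -/
def MsgSound (H : List (Net IP Data)) (S : IP → Prop) : Msg IP Data → Prop
  | .rreq hops _ _ _ _ oip _ sip => S sip ∧ HasPath H hops sip oip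
  | .rrep hops dip _ _ sip => S sip ∧ HasPath H hops sip dip
  | .rerr _ sip => S sip
  | .newpkt _ _ => True
  | .pkt _ _ _ => True

theorem MsgSound.imp {H : List (Net IP Data)} {S T : IP → Prop} {m : Msg IP Data}
    (h : MsgSound H S m) (hST : ∀ s, S s → T s) : MsgSound H T m := by
  cases m <;> first | exact trivial | exact hST _ h | exact ⟨hST _ h.1, h.2⟩

/-! ### Contracts and verification conditions of sequential processes -/

/-- What a sequential process relies on and guarantees. -/
structure Contract (IP Data : Type) where
  /-- invariant of the valuation -/
  inv : Val IP Data → Prop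
  /-- the messages the process may assume to receive -/
  input : Msg IP Data → Prop
  /-- the messages the process may broadcast, groupcast and unicast -/
  cast : Msg IP Data → Prop
  /-- the messages the process may send to another process on the same node -/
  send : Msg IP Data → Prop
  /-- preconditions of the process names -/
  pre : PName → Val IP Data → Prop

/-- The verification condition of a process expression in a valuation: whatever the process does
until it calls a process name, the contract is respected, and the precondition of the process name
holds when it is called. -/
def SP.Sat (C : Contract IP Data) : SP IP Data → Val IP Data → Prop
  | .call X args, ξ => C.inv ξ ∧ C.pre X (callVal X args ξ)
  | .guard φ p, ξ => C.inv ξ ∧ ∀ ζ, Extends ξ φ ζ → p.Sat C ζ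
  | .assign v e p, ξ => C.inv ξ ∧ ∀ x, e ξ = some x → p.Sat C (Function.update ξ v (some x))
  | .choice p q, ξ => p.Sat C ξ ∧ q.Sat C ξ
  | .broadcast ms p, ξ => C.inv ξ ∧ ∀ m, ms ξ = some m → C.cast m ∧ p.Sat C ξ
  | .groupcast _ ms p, ξ => C.inv ξ ∧ ∀ m, ms ξ = some m → C.cast m ∧ p.Sat C ξ
  | .unicast _ ms p q, ξ => C.inv ξ ∧ ∀ m, ms ξ = some m → C.cast m ∧ p.Sat C ξ ∧ q.Sat C ξ
  | .send ms p, ξ => C.inv ξ ∧ ∀ m, ms ξ = some m → C.send m ∧ p.Sat C ξ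
  | .deliver _ p, ξ => C.inv ξ ∧ p.Sat C ξ
  | .receive p, ξ => C.inv ξ ∧ ∀ m, C.input m → p.Sat C (Function.update ξ .msg (some m))

theorem SP.Sat.inv {C : Contract IP Data} {p : SP IP Data} {ξ : Val IP Data} (h : p.Sat C ξ) :
    C.inv ξ := by
  induction p with
  | choice p q hp hq => exact hp h.1
  | _ => exact h.1

/-- The messages received in an action are those a contract allows to assume. -/
def Contract.Assumes (C : Contract IP Data) : Act IP Data → Prop
  | .receive m => C.input m
  | _ => True

/-- The messages cast or sent in an action are those a contract allows. -/
def Contract.Guarantees (C : Contract IP Data) : Act IP Data → Prop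
  | .broadcast m => C.cast m
  | .groupcast _ m => C.cast m
  | .unicast _ m => C.cast m
  | .send m => C.send m
  | _ => True

/-- Verification conditions are preserved by steps, provided that the body of each process name
satisfies its own under the precondition of the name. -/
theorem SPStep.sat {Γ : PName → SP IP Data} {C : Contract IP Data}
    (hΓ : ∀ X ξ, C.pre X ξ → (Γ X).Sat C ξ) {ξ ζ : Val IP Data} {p q : SP IP Data}
    {a : Act IP Data} (h : SPStep Γ ξ p a ζ q) (hp : p.Sat C ξ) (ha : C.Assumes a) :
    C.Guarantees a ∧ q.Sat C ζ := by
  induction h with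
  | broadcast hm => exact hp.2 _ hm
  | groupcast _ hm => exact hp.2 _ hm
  | unicast _ hm => exact ⟨(hp.2 _ hm).1, (hp.2 _ hm).2.1⟩
  | notUnicast _ hm => exact ⟨trivial, (hp.2 _ hm).2.2⟩
  | send hm => exact hp.2 _ hm
  | deliver => exact ⟨trivial, hp.2⟩
  | receive m => exact ⟨trivial, hp.2 m ha⟩
  | assign he => exact ⟨trivial, hp.2 _ he⟩
  | call _ _ ih => exact ih (hΓ _ _ hp.2) ha
  | left _ ih => exact ih hp.1 ha
  | right _ ih => exact ih hp.2 ha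
  | guard hζ => exact ⟨trivial, hp.2 _ hζ⟩

theorem Extends.eq_some {ξ ζ : Val IP Data} {φ : Formula IP Data} (h : Extends ξ φ ζ) {v : Var}
    {x : Ty IP Data v} (hx : ξ v = some x) : ζ v = some x := by
  rw [h.1 v (by rw [hx]; exact Option.some_ne_none x), hx]

/-! ### The message queue -/

/-- The contract of the queue process of node `ip`: only messages that are sound for `ip` are
queued. -/
def queueContract (H : List (Net IP Data)) (ip : IP) : Contract IP Data where
  inv _ := True
  input := MsgSound H (Arc H ip)
  cast _ := False
  send := MsgSound H (Arc H ip)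
  pre X ζ := X = .qmsg ∧ ∃ l, ζ .msgs = some l ∧ ∀ m ∈ l, MsgSound H (Arc H ip) m

theorem storeMsg_sat {H : List (Net IP Data)} {ip : IP} {ζ : Val IP Data} {l : List (Msg IP Data)}
    (hl : ζ .msgs = some l) (h : ∀ m ∈ l, MsgSound H (Arc H ip) m) :
    storeMsg.Sat (queueContract H ip) ζ := by
  refine ⟨trivial, fun m hm => ⟨trivial, rfl, l ++ [m], ?_, ?_⟩⟩
  · simp [callVal, PName.params, hl]
  · intro m' hm'
    rcases List.mem_append.1 hm' with h' | h'
    · exact h m' h'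
    · rw [List.mem_singleton.1 h']
      exact hm

theorem spec_sat_queueContract (H : List (Net IP Data)) (ip : IP) (X : PName) (ζ : Val IP Data)
    (hX : (queueContract H ip).pre X ζ) : (spec X).Sat (queueContract H ip) ζ := by
  obtain ⟨rfl, l, hl, h⟩ := hX
  refine ⟨storeMsg_sat hl h, trivial, fun ζ' hζ' => ?_⟩
  replace hl := hζ'.eq_some hl
  refine ⟨⟨trivial, fun m hm => ?_⟩, storeMsg_sat hl h⟩
  cases l with
  | nil => simp [hl] at hm
  | cons m' l =>
    obtain rfl : m' = m := by simpa [hl] using hm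
    refine ⟨h _ List.mem_cons_self, trivial, rfl, l, ?_, fun m hm => h m (List.mem_cons_of_mem _ hm)⟩
    simp [callVal, PName.params, hl]

/-! ### The routing process -/

/-- The invariant of the valuations of the routing process of node `ip`. Address and routing table
have to be defined, since a guard may give any value to an undefined variable. -/
def ValSound (H : List (Net IP Data)) (ip : IP) (ξ : Val IP Data) : Prop :=
  ξ .ip = some ip ∧ ∃ rt, ξ .rt = some rt ∧ RTSound H ip rt

/-- The variables describing a route from the sender of a message to `w`, its originator or
destination, are sound for the node `ip` that handles the message. -/
def ClaimSound (H : List (Net IP Data)) (ip : IP) (n : Option ℕ) (sip w : Option IP) : Prop :=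
  ∃ k s d, n = some k ∧ sip = some s ∧ w = some d ∧ Arc H ip s ∧ HasPath H k s d

/-- The contract of the routing process of node `ip`. -/
def aodvContract (H : List (Net IP Data)) (ip : IP) : Contract IP Data where
  inv := ValSound H ip
  input := MsgSound H (Arc H ip)
  cast := MsgSound H (· = ip)
  send _ := True
  pre X ξ := ValSound H ip ξ ∧
    match X with
    | .rreq => ClaimSound H ip (ξ .hops) (ξ .sip) (ξ .oip)
    | .rrep => ClaimSound H ip (ξ .hops) (ξ .sip) (ξ .dip)
    | .qmsg => False
    | _ => True

namespace ValSound

variable {H : List (Net IP Data)} {ip : IP} {ξ ζ : Val IP Data}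

theorem extend {φ : Formula IP Data} (h : ValSound H ip ξ) (hζ : Extends ξ φ ζ) :
    ValSound H ip ζ := by
  obtain ⟨hip, rt, hrt, hs⟩ := h
  exact ⟨hζ.eq_some hip, rt, hζ.eq_some hrt, hs⟩

theorem update (h : ValSound H ip ξ) {v : Var} (x : Option (Ty IP Data v)) (h₁ : v ≠ .ip)
    (h₂ : v ≠ .rt) : ValSound H ip (Function.update ξ v x) := by
  rwa [ValSound, Function.update_of_ne h₁.symm, Function.update_of_ne h₂.symm]

theorem update_rt (h : ValSound H ip ξ) {rt : RT IP} (hrt : RTSound H ip rt) :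
    ValSound H ip (Function.update ξ .rt (some rt)) :=
  ⟨by rw [Function.update_of_ne (by decide)]; exact h.1, rt, Function.update_self .., hrt⟩

theorem callVal (h : ValSound H ip ξ) {X : PName} (h₁ : Var.ip ∈ X.params)
    (h₂ : Var.rt ∈ X.params) : ValSound H ip (callVal X (fun v ξ => ξ v) ξ) := by
  simpa only [ValSound, AODV.callVal, h₁, h₂, if_true] using h

theorem sat_main (h : ValSound H ip ξ) : SP.main.Sat (aodvContract H ip) ξ :=
  ⟨h, h.callVal (by decide) (by decide), trivial⟩

theorem sat_sendError (h : ValSound H ip ξ) : SP.sendError.Sat (aodvContract H ip) ξ := by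
  refine ⟨h, fun rt hrt => ?_⟩
  replace h : ValSound H ip (Function.update ξ .rt (some rt)) := by
    obtain ⟨hip, rt₀, hrt₀, hs⟩ := h
    obtain ⟨d, -, rfl⟩ : ∃ d, ξ .dests = some d ∧ rt₀.invalidate d = rt := by
      simpa [hrt₀, Option.bind_eq_some_iff] using hrt
    exact update_rt ⟨hip, rt₀, hrt₀, hs⟩ (hs.invalidate d)
  refine ⟨h, fun _ _ => ?_⟩
  replace h := h.update (v := .store) (some ‹_›) (by decide) (by decide)
  refine ⟨h, fun _ _ => ?_⟩
  replace h := h.update (v := .pre) (some ‹_›) (by decide) (by decide)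
  refine ⟨h, fun _ _ => ?_⟩
  replace h := h.update (v := .dests) (some ‹_›) (by decide) (by decide)
  refine ⟨h, fun m hm => ⟨?_, h.sat_main⟩⟩
  obtain ⟨d, -, rfl⟩ := by simpa only [h.1, Option.bind_eq_bind, Option.bind_eq_some_iff,
    Option.bind_some, Option.pure_def, Option.some.injEq] using hm
  exact rfl

theorem sat_linkBreak (h : ValSound H ip ξ) (dst : Exp IP Data IP) :
    (SP.linkBreak dst).Sat (aodvContract H ip) ξ :=
  ⟨h, fun _ _ => (h.update (v := .dests) _ (by decide) (by decide)).sat_sendError⟩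

end ValSound

theorem ValSound.update_addpreRT {H : List (Net IP Data)} {ip : IP} {ξ : Val IP Data} {rt' : RT IP}
    (h : ValSound H ip ξ)
    (h' : ∃ rt dip npre, ξ .rt = some rt ∧ rt.addpreRT dip npre = some rt') :
    ValSound H ip (Function.update ξ .rt (some rt')) := by
  obtain ⟨rt, dip, npre, hrt, hu⟩ := h'
  obtain ⟨rt₀, hrt₀, hsound⟩ := h.2
  obtain rfl := Option.some.inj (hrt₀.symm.trans hrt)
  exact h.update_rt (hsound.addpreRT hu)

theorem ValSound.sat_updateSender {H : List (Net IP Data)} {ip s : IP} {ξ : Val IP Data}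
    (h : ValSound H ip ξ) (hs : ξ .sip = some s) (ha : Arc H ip s) {p : SP IP Data}
    (hp : ∀ rt, ValSound H ip (Function.update ξ .rt (some rt)) →
      p.Sat (aodvContract H ip) (Function.update ξ .rt (some rt))) :
    p.updateSender.Sat (aodvContract H ip) ξ := by
  refine ⟨h, fun rt' hrt' => hp rt' ?_⟩
  obtain ⟨rt, hrt, hsound⟩ := h.2
  simp only [hrt, hs, Option.bind_eq_bind, Option.bind_some] at hrt'
  exact h.update_rt (hsound.update ha.routeSound_senderRoute hrt')

theorem aodvBody_sat {H : List (Net IP Data)} {ip : IP} {ξ : Val IP Data} (hV : Vertex H ip)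
    (h : ValSound H ip ξ) : aodvBody.Sat (aodvContract H ip) ξ := by
  refine ⟨⟨h, fun m hm => ?_⟩, ⟨h, fun ζ hζ => ?_⟩, h, fun ζ hζ => ?_⟩
  · replace h := h.update (v := .msg) (some m) (by decide) (by decide)
    have hmsg : Function.update ξ Var.msg (some m) .msg = some m := Function.update_self ..
    generalize Function.update ξ Var.msg (some m) = ξ at h hmsg
    -- one case for each type of message; the guard makes the variables its components
    refine ⟨⟨h, fun ζ hζ => ?_⟩, ⟨h, fun ζ hζ => ?_⟩, ⟨h, fun ζ hζ => ?_⟩, ⟨h, fun ζ hζ => ?_⟩,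
      h, fun ζ hζ => ?_⟩
    all_goals
      obtain ⟨m', hm', he⟩ := hζ.2.2
      obtain rfl := Option.some.inj (hm'.symm.trans (hζ.eq_some hmsg))
      replace h := h.extend hζ
      simp only [Option.bind_eq_bind, Option.bind_eq_some_iff, Option.pure_def,
        Option.some.injEq] at he
    · exact ⟨h, h.callVal (by decide) (by decide), trivial⟩
    · exact ⟨h, h.callVal (by decide) (by decide), trivial⟩
    · obtain ⟨k, hk, _, -, _, -, _, -, _, -, o, ho, _, -, s, hs, rfl⟩ := he
      exact h.sat_updateSender hs hm.1 fun rt h =>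
        ⟨h, h.callVal (by decide) (by decide), k, s, o, hk, hs, ho, hm⟩
    · obtain ⟨k, hk, d, hd, _, -, _, -, s, hs, rfl⟩ := he
      exact h.sat_updateSender hs hm.1 fun rt h =>
        ⟨h, h.callVal (by decide) (by decide), k, s, d, hk, hs, hd, hm⟩
    · obtain ⟨_, -, s, hs, rfl⟩ := he
      exact h.sat_updateSender hs hm fun rt h => ⟨h, h.callVal (by decide) (by decide), trivial⟩
  · replace h := h.extend hζ
    refine ⟨h, fun d hd => ?_⟩
    replace h := h.update (v := .data) (some d) (by decide) (by decide)
    refine ⟨h, fun m hm => ⟨?_, ?_, h.sat_linkBreak _⟩⟩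
    · simp only [Option.bind_eq_bind, Option.bind_eq_some_iff, Option.pure_def,
        Option.some.injEq] at hm
      obtain ⟨-, -, -, -, -, -, rfl⟩ := hm
      exact trivial
    · exact ⟨h, fun st _ => (h.update (v := .store) _ (by decide) (by decide)).sat_main⟩
  · replace h := h.extend hζ
    refine ⟨h, fun _ _ => ?_⟩
    replace h := h.update (v := .store) (some ‹_›) (by decide) (by decide)
    refine ⟨h, fun _ _ => ?_⟩
    replace h := h.update (v := .sn) (some ‹_›) (by decide) (by decide)
    refine ⟨h, fun _ _ => ?_⟩
    replace h := h.update (v := .rreqid) (some ‹_›) (by decide) (by decide)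
    refine ⟨h, fun _ _ => ?_⟩
    replace h := h.update (v := .rreqs) (some ‹_›) (by decide) (by decide)
    refine ⟨h, fun m hm => ⟨?_, h.sat_main⟩⟩
    simp only [h.1, Option.bind_eq_bind, Option.bind_eq_some_iff, Option.pure_def,
      Option.some.injEq, exists_eq_left'] at hm
    obtain ⟨-, -, -, -, -, -, -, -, rfl⟩ := hm
    -- a new route request claims the path without hops from the node to itself
    exact ⟨rfl, HasPath.zero hV⟩

theorem newpktBody_sat {H : List (Net IP Data)} {ip : IP} {ξ : Val IP Data}
    (h : ValSound H ip ξ) : newpktBody.Sat (aodvContract H ip) ξ := by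
  refine ⟨⟨h, fun ζ hζ => ?_⟩, h, fun ζ hζ => ?_⟩
  all_goals replace h := h.extend hζ
  · exact ⟨h, h.sat_main⟩
  · exact ⟨h, fun _ _ => (h.update (v := .store) _ (by decide) (by decide)).sat_main⟩

theorem pktBody_sat {H : List (Net IP Data)} {ip : IP} {ξ : Val IP Data}
    (h : ValSound H ip ξ) : pktBody.Sat (aodvContract H ip) ξ := by
  refine ⟨⟨h, fun ζ hζ => ⟨h.extend hζ, (h.extend hζ).sat_main⟩⟩, h, fun ζ hζ => ?_⟩
  replace h := h.extend hζ
  refine ⟨⟨h, fun ζ hζ => ?_⟩, h, fun ζ hζ => ?_⟩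
  · replace h := h.extend hζ
    refine ⟨h, fun m hm => ⟨?_, h.sat_main, h.sat_linkBreak _⟩⟩
    simp only [Option.bind_eq_bind, Option.bind_eq_some_iff, Option.pure_def,
      Option.some.injEq] at hm
    obtain ⟨-, -, -, -, -, -, rfl⟩ := hm
    exact trivial
  · replace h := h.extend hζ
    refine ⟨⟨h, fun ζ hζ => ?_⟩, h, fun ζ hζ => (h.extend hζ).sat_main⟩
    replace h := h.extend hζ
    refine ⟨h, fun m hm => ⟨?_, h.sat_main⟩⟩
    simp only [h.1, Option.bind_eq_bind, Option.bind_eq_some_iff, Option.pure_def,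
      Option.some.injEq, exists_eq_left'] at hm
    obtain ⟨-, -, -, -, rfl⟩ := hm
    exact rfl

theorem rerrBody_sat {H : List (Net IP Data)} {ip : IP} {ξ : Val IP Data}
    (h : ValSound H ip ξ) : rerrBody.Sat (aodvContract H ip) ξ :=
  ⟨h, fun _ _ => (h.update (v := .dests) _ (by decide) (by decide)).sat_sendError⟩

theorem rreqBody_sat {H : List (Net IP Data)} {ip : IP} {ξ : Val IP Data} (hV : Vertex H ip)
    (h : ValSound H ip ξ) (hc : ClaimSound H ip (ξ .hops) (ξ .sip) (ξ .oip)) :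
    rreqBody.Sat (aodvContract H ip) ξ := by
  refine ⟨⟨h, fun ζ hζ => (h.extend hζ).sat_main⟩, h, fun ζ hζ => ?_⟩
  replace h := h.extend hζ
  obtain ⟨k, s, o, hk, hs, ho, ha, hp⟩ := hc
  replace hk := hζ.eq_some hk
  replace hs := hζ.eq_some hs
  replace ho := hζ.eq_some ho
  clear hζ
  refine ⟨h, fun rt' hrt' => ?_⟩
  replace h : ValSound H ip (Function.update ζ .rt (some rt')) := by
    obtain ⟨rt, hrt, hsound⟩ := h.2
    simp only [hrt, hk, hs, ho, Option.bind_eq_bind, Option.bind_eq_some_iff,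
      Option.some.injEq, exists_eq_left'] at hrt'
    obtain ⟨osn, -, hu⟩ := hrt'
    exact h.update_rt (hsound.update (hp.routeSound ha _ _ _ _) hu)
  refine ⟨h, fun rs _ => ?_⟩
  replace h := h.update (v := .rreqs) (some rs) (by decide) (by decide)
  -- the new values of `rt` and `rreqs` do not affect the variables of the claimed route
  replace hk : Function.update (Function.update ζ .rt (some rt')) .rreqs (some rs) .hops = some k :=
    hk
  replace ho : Function.update (Function.update ζ .rt (some rt')) .rreqs (some rs) .oip = some o :=
    ho
  generalize Function.update (Function.update ζ .rt (some rt')) .rreqs (some rs) = ξ at h hk ho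
  refine ⟨⟨h, fun ζ hζ => ?_⟩, h, fun ζ hζ => ?_⟩
  · obtain ⟨d, hd, hip⟩ := hζ.2.2
    replace h := h.extend hζ
    obtain rfl : ip = d := Option.some.inj (h.1.symm.trans hip)
    refine ⟨h, fun sn _ => ?_⟩
    replace hd : Function.update ζ .sn (some sn) .dip = some ip := hd
    replace h := h.update (v := .sn) (some sn) (by decide) (by decide)
    refine ⟨h, fun m hm => ⟨?_, h.sat_main, h.sat_linkBreak _⟩⟩
    simp only [h.1, hd, Option.bind_eq_bind, Option.bind_eq_some_iff, Option.pure_def,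
      Option.some.injEq, exists_eq_left'] at hm
    obtain ⟨-, -, -, -, rfl⟩ := hm
    -- the destination replies with the path without hops to itself
    exact ⟨rfl, HasPath.zero hV⟩
  · replace h := h.extend hζ
    replace hk := hζ.eq_some hk
    replace ho := hζ.eq_some ho
    refine ⟨⟨h, fun ζ hζ => ?_⟩, h, fun ζ hζ => ?_⟩
    · replace h := h.extend hζ
      refine ⟨h, fun rt₁ hrt₁ => ?_⟩
      simp only [Option.bind_eq_bind, Option.bind_eq_some_iff] at hrt₁
      obtain ⟨rt, hrt, d, -, s, -, hu⟩ := hrt₁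
      replace h := h.update_addpreRT ⟨rt, _, _, hrt, hu⟩
      refine ⟨h, fun rt₂ hrt₂ => ?_⟩
      simp only [Option.bind_eq_bind, Option.bind_eq_some_iff] at hrt₂
      obtain ⟨rt, hrt, o', -, d, -, n, -, hu⟩ := hrt₂
      replace h := h.update_addpreRT ⟨rt, _, _, hrt, hu⟩
      refine ⟨h, fun m hm => ⟨?_, h.sat_main, h.sat_linkBreak _⟩⟩
      obtain ⟨rt, hrt, hsound⟩ := h.2
      simp only [h.1, hrt, Option.bind_eq_bind, Option.bind_eq_some_iff, Option.pure_def,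
        Option.some.injEq, exists_eq_left'] at hm
      obtain ⟨_, -, _, hn, _, -, rfl⟩ := hm
      -- an intermediate node replies with the route in its table
      exact ⟨rfl, hsound.hasPath_of_dhops hn⟩
    · replace h := h.extend hζ
      replace hk := hζ.eq_some hk
      replace ho := hζ.eq_some ho
      refine ⟨h, fun m hm => ⟨?_, h.sat_main⟩⟩
      simp only [h.1, hk, ho, Option.bind_eq_bind, Option.bind_eq_some_iff, Option.pure_def,
        Option.some.injEq, exists_eq_left'] at hm
      obtain ⟨-, -, -, -, -, -, -, -, -, -, -, -, rfl⟩ := hm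
      -- the forwarded request claims the received route, extended by the arc to its sender
      exact ⟨rfl, hp.cons ha⟩

theorem rrepBody_sat {H : List (Net IP Data)} {ip : IP} {ξ : Val IP Data}
    (h : ValSound H ip ξ) (hc : ClaimSound H ip (ξ .hops) (ξ .sip) (ξ .dip)) :
    rrepBody.Sat (aodvContract H ip) ξ := by
  refine ⟨⟨h, fun ζ hζ => ?_⟩, h, fun ζ hζ => (h.extend hζ).sat_main⟩
  replace h := h.extend hζ
  obtain ⟨k, s, d, hk, hs, hd, ha, hp⟩ := hc
  replace hk := hζ.eq_some hk
  replace hs := hζ.eq_some hs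
  replace hd := hζ.eq_some hd
  clear hζ
  refine ⟨h, fun rt' hrt' => ?_⟩
  replace h : ValSound H ip (Function.update ζ .rt (some rt')) := by
    obtain ⟨rt, hrt, hsound⟩ := h.2
    simp only [replyUpdate, hrt, hk, hs, hd, Option.bind_eq_bind, Option.bind_eq_some_iff,
      Option.some.injEq, exists_eq_left'] at hrt'
    obtain ⟨dsn, -, hu⟩ := hrt'
    exact h.update_rt (hsound.update (hp.routeSound ha _ _ _ _) hu)
  -- the new value of `rt` does not affect the variables of the claimed route
  replace hk : Function.update ζ .rt (some rt') .hops = some k := hk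
  replace hd : Function.update ζ .rt (some rt') .dip = some d := hd
  generalize Function.update ζ .rt (some rt') = ξ at h hk hd
  refine ⟨⟨h, fun ζ hζ => (h.extend hζ).sat_main⟩, h, fun ζ hζ => ?_⟩
  replace h := h.extend hζ
  replace hk := hζ.eq_some hk
  replace hd := hζ.eq_some hd
  refine ⟨⟨h, fun η hη => ?_⟩, h, fun η hη => (h.extend hη).sat_main⟩
  replace h := h.extend hη
  replace hk := hη.eq_some hk
  replace hd := hη.eq_some hd
  refine ⟨h, fun rt₁ hrt₁ => ?_⟩
  simp only [Option.bind_eq_bind, Option.bind_eq_some_iff] at hrt₁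
  obtain ⟨rt, hrt, d', -, o, -, n, -, hu⟩ := hrt₁
  replace h := h.update_addpreRT ⟨rt, _, _, hrt, hu⟩
  refine ⟨h, fun rt₂ hrt₂ => ?_⟩
  simp only [Option.bind_eq_bind, Option.bind_eq_some_iff] at hrt₂
  obtain ⟨rt, hrt, d', -, n, -, o, -, n', -, hu⟩ := hrt₂
  replace h := h.update_addpreRT ⟨rt, _, _, hrt, hu⟩
  refine ⟨h, fun m hm => ⟨?_, h.sat_main, h.sat_linkBreak _⟩⟩
  replace hk : Function.update (Function.update η .rt (some rt₁)) .rt (some rt₂) .hops = some k :=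
    hk
  replace hd : Function.update (Function.update η .rt (some rt₁)) .rt (some rt₂) .dip = some d :=
    hd
  simp only [h.1, hk, hd, Option.bind_eq_bind, Option.bind_eq_some_iff, Option.pure_def,
    Option.some.injEq, exists_eq_left'] at hm
  obtain ⟨_, -, _, -, rfl⟩ := hm
  -- the forwarded reply claims the received route, extended by the arc to its sender
  exact ⟨rfl, hp.cons ha⟩

theorem spec_sat_aodvContract {H : List (Net IP Data)} {ip : IP} (hV : Vertex H ip) (X : PName)
    (ξ : Val IP Data) (hX : (aodvContract H ip).pre X ξ) : (spec X).Sat (aodvContract H ip) ξ := by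
  obtain ⟨h, hc⟩ := hX
  cases X with
  | aodv => exact aodvBody_sat hV h
  | newpkt => exact newpktBody_sat h
  | pkt => exact pktBody_sat h
  | rreq => exact rreqBody_sat hV h hc
  | rrep => exact rrepBody_sat h hc
  | rerr => exact rerrBody_sat h
  | qmsg => exact hc.elim

/-! ### Nodes -/

/-- The invariant of the parallel process of node `ip`: its routing process and its queue satisfy
the verification conditions of their contracts. -/
def NodeSound (H : List (Net IP Data)) (ip : IP) (P : PP IP Data) : Prop :=
  ∃ ξ p ζ q, P = .par (.seq ξ p) (.seq ζ q) ∧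
    p.Sat (aodvContract H ip) ξ ∧ q.Sat (queueContract H ip) ζ

/-- The condition on the actions of node `ip` under which its invariant is preserved. -/
def Act.RecvSound (H : List (Net IP Data)) (ip : IP) : Act IP Data → Prop
  | .receive m => MsgSound H (Arc H ip) m
  | _ => True

/-- The guarantee about the actions of node `ip`: the messages it casts are sound. -/
def Act.CastSound (H : List (Net IP Data)) (ip : IP) : Act IP Data → Prop
  | .broadcast m => MsgSound H (· = ip) m
  | .groupcast _ m => MsgSound H (· = ip) m
  | .unicast _ m => MsgSound H (· = ip) m
  | _ => True

theorem InitialPP.nodeSound {H : List (Net IP Data)} {ip : IP} {P : PP IP Data}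
    (h : InitialPP ip P) : NodeSound H ip P := by
  obtain ⟨ξ, ζ, rfl, hip, -, hrt, -, -, hmsgs⟩ := h
  refine ⟨_, _, _, _, rfl, ValSound.sat_main ⟨hip, _, hrt, RTSound.empty⟩, trivial, rfl, [], ?_, ?_⟩
  · simp [callVal, PName.params, hmsgs]
  · simp

theorem PPStep.nodeSound {H : List (Net IP Data)} {ip : IP} {P P' : PP IP Data} {a : Act IP Data}
    (hV : Vertex H ip) (h : PPStep spec P a P') (hP : NodeSound H ip P)
    (ha : a.RecvSound H ip) : a.CastSound H ip ∧ NodeSound H ip P' := by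
  obtain ⟨ξ, p, ζ, q, rfl, hp, hq⟩ := hP
  have hΓ := spec_sat_aodvContract (Data := Data) hV
  have hΓ' := spec_sat_queueContract H ip
  cases h with
  | left h hr =>
    cases h with
    | seq h =>
      have := h.sat hΓ hp (by cases a <;> first | exact trivial | exact absurd rfl (hr _))
      refine ⟨?_, _, _, _, _, rfl, this.2, hq⟩
      cases a <;> first | exact trivial | exact this.1
  | right h hs =>
    cases h with
    | seq h =>
      have := h.sat hΓ' hq (by cases a <;> first | exact trivial | exact ha)
      refine ⟨?_, _, _, _, _, rfl, hp, this.2⟩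
      cases a <;> first | exact trivial | exact this.1.elim
  | sync h h' =>
    cases h with
    | seq h =>
      cases h' with
      | seq h' =>
        have hQ := h'.sat hΓ' hq trivial
        have hA := h.sat hΓ hp hQ.1
        exact ⟨trivial, _, _, _, _, rfl, hA.2, hQ.2⟩

/-! ### Ranges -/

/-- In the list `l` of node expressions, nodes are in range of each other in both directions or
not at all. -/
def RangesSymmetric (l : List (IP × PP IP Data × Set IP)) : Prop :=
  ∀ n ∈ l, ∀ n' ∈ l, n'.1 ∈ n.2.2 ↔ n.1 ∈ n'.2.2

/-- The address `x` is in the range of node `ip` after a transition with label `ℓ`, if before the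
transition the range is `R`. -/
def Label.InRangeAfter (ip : IP) (R : Set IP) (x : IP) : Label IP Data → Prop
  | .connect a b => x ∈ R ∨ (ip = a ∧ x = b) ∨ (ip = b ∧ x = a)
  | .disconnect a b => x ∈ R ∧ ¬ ((ip = a ∧ x = b) ∨ (ip = b ∧ x = a))
  | _ => x ∈ R

/-- Transitions keep addresses and change ranges as their labels say. -/
theorem PNetStep.exists_inRangeAfter {Γ : PName → SP IP Data} {M M' : PNet IP Data}
    {ℓ : Label IP Data} (h : PNetStep Γ M ℓ M') :
    ∀ n' ∈ M'.nodes, ∃ n ∈ M.nodes, n.1 = n'.1 ∧ ∀ x, x ∈ n'.2.2 ↔ ℓ.InRangeAfter n.1 n.2.2 x := by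
  induction h with
  | castLeft _ _ _ _ ih₁ ih₂ | castRight _ _ _ _ ih₁ ih₂ | arrive _ _ ih₁ ih₂
  | connectPar _ _ ih₁ ih₂ | disconnectPar _ _ ih₁ ih₂ =>
    intro n' hn'
    rcases List.mem_append.1 hn' with hn' | hn'
    · exact (ih₁ n' hn').imp fun n h => h.imp_left (List.mem_append_left _)
    · exact (ih₂ n' hn').imp fun n h => h.imp_left (List.mem_append_right _)
  | deliverLeft _ ih | tauLeft _ ih =>
    intro n' hn'
    rcases List.mem_append.1 hn' with hn' | hn'
    · exact (ih n' hn').imp fun n h => h.imp_left (List.mem_append_left _)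
    · exact ⟨n', List.mem_append_right _ hn', rfl, fun _ => Iff.rfl⟩
  | deliverRight _ ih | tauRight _ ih =>
    intro n' hn'
    rcases List.mem_append.1 hn' with hn' | hn'
    · exact ⟨n', List.mem_append_left _ hn', rfl, fun _ => Iff.rfl⟩
    · exact (ih n' hn').imp fun n h => h.imp_left (List.mem_append_right _)
  | _ =>
    intro n' hn'
    obtain rfl := List.mem_singleton.1 hn'
    refine ⟨_, List.mem_singleton_self _, rfl, fun x => ?_⟩
    simp only [Label.InRangeAfter, Set.mem_union, Set.mem_sdiff, Set.mem_singleton_iff]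
    try grind

theorem PNetStep.rangesSymmetric {Γ : PName → SP IP Data} {M M' : PNet IP Data}
    {ℓ : Label IP Data} (h : PNetStep Γ M ℓ M') (hM : RangesSymmetric M.nodes) :
    RangesSymmetric M'.nodes := by
  intro a' ha' b' hb'
  obtain ⟨a, ha, haa, hra⟩ := h.exists_inRangeAfter a' ha'
  obtain ⟨b, hb, hbb, hrb⟩ := h.exists_inRangeAfter b' hb'
  rw [hra, hrb, ← haa, ← hbb]
  have := hM a ha b hb
  cases ℓ <;> simp only [Label.InRangeAfter] <;> tauto

/-! ### Networks and histories -/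

/-- The message of a transition, if any, is sound for the receiving nodes with address in `W`. -/
def Label.RecvSound (H : List (Net IP Data)) (W : Set IP) : Label IP Data → Prop
  | .cast R m => ∀ ip ∈ R, ip ∈ W → MsgSound H (Arc H ip) m
  | .arrive A _ m => ∀ ip ∈ A, ip ∈ W → MsgSound H (Arc H ip) m
  | _ => True

theorem PNetStep.nodeSound {H : List (Net IP Data)} {W : Set IP} {M M' : PNet IP Data}
    {ℓ : Label IP Data} (h : PNetStep spec M ℓ M') (hV : ∀ ip ∈ W, Vertex H ip)
    (hW : ∀ n ∈ M.nodes, n.1 ∈ W) (hM : ∀ n ∈ M.nodes, NodeSound H n.1 n.2.1)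
    (hℓ : ℓ.RecvSound H W) : ∀ n ∈ M'.nodes, NodeSound H n.1 n.2.1 := by
  induction h with
  | broadcast h | groupcast h | unicast h | notUnicast h | deliver h | tau h | receive h =>
    intro n hn
    obtain rfl := List.mem_singleton.1 hn
    have hw := hW _ (List.mem_singleton_self _)
    refine (h.nodeSound (hV _ hw) (hM _ (List.mem_singleton_self _)) ?_).2
    first | exact trivial | exact hℓ _ rfl hw
  | disregard | connect | disconnect | connect' | disconnect' | connectOther | disconnectOther =>
    intro n hn
    obtain rfl := List.mem_singleton.1 hn
    -- at most the range of the node changes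
    exact (hM _ (List.mem_singleton_self _) :)
  | castLeft _ _ hR _ ih₁ ih₂ =>
    simp only [PNet.nodes, List.forall_mem_append] at hW hM ⊢
    exact ⟨ih₁ hW.1 hM.1 hℓ, ih₂ hW.2 hM.2 fun ip hip => hℓ ip (hR hip)⟩
  | castRight _ _ hR _ ih₁ ih₂ =>
    simp only [PNet.nodes, List.forall_mem_append] at hW hM ⊢
    exact ⟨ih₁ hW.1 hM.1 fun ip hip => hℓ ip (hR hip), ih₂ hW.2 hM.2 hℓ⟩
  | arrive _ _ ih₁ ih₂ =>
    simp only [PNet.nodes, List.forall_mem_append] at hW hM ⊢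
    exact ⟨ih₁ hW.1 hM.1 fun ip hip => hℓ ip (.inl hip),
      ih₂ hW.2 hM.2 fun ip hip => hℓ ip (.inr hip)⟩
  | connectPar _ _ ih₁ ih₂ | disconnectPar _ _ ih₁ ih₂ =>
    simp only [PNet.nodes, List.forall_mem_append] at hW hM ⊢
    exact ⟨ih₁ hW.1 hM.1 trivial, ih₂ hW.2 hM.2 trivial⟩
  | deliverLeft _ ih | tauLeft _ ih =>
    simp only [PNet.nodes, List.forall_mem_append] at hW hM ⊢
    exact ⟨ih hW.1 hM.1 trivial, hM.2⟩
  | deliverRight _ ih | tauRight _ ih =>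
    simp only [PNet.nodes, List.forall_mem_append] at hW hM ⊢
    exact ⟨hM.1, ih hW.2 hM.2 trivial⟩

/-- The receivers of a cast message are in the range of a node for which the message is sound as
one of its own. -/
theorem PNetStep.exists_caster {H : List (Net IP Data)} {M M' : PNet IP Data} {R : Set IP}
    {m : Msg IP Data} (h : PNetStep spec M (.cast R m) M') (hV : ∀ n ∈ M.nodes, Vertex H n.1)
    (hM : ∀ n ∈ M.nodes, NodeSound H n.1 n.2.1) :
    ∃ n ∈ M.nodes, R ⊆ n.2.2 ∧ MsgSound H (· = n.1) m := by
  generalize hℓ : Label.cast R m = ℓ at h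
  induction h with
  | broadcast h | groupcast h | unicast h hd =>
    cases hℓ
    refine ⟨_, List.mem_singleton_self _, ?_, (h.nodeSound (hV _ (List.mem_singleton_self _))
      (hM _ (List.mem_singleton_self _)) trivial).1⟩
    first
      | exact subset_rfl
      | exact Set.inter_subset_left
      | exact Set.singleton_subset_iff.2 hd
  | castLeft _ _ _ _ ih =>
    cases hℓ
    simp only [PNet.nodes, List.forall_mem_append] at hV hM
    exact (ih hV.1 hM.1 rfl).imp fun n h => h.imp_left (List.mem_append_left _)
  | castRight _ _ _ _ _ ih =>
    cases hℓ
    simp only [PNet.nodes, List.forall_mem_append] at hV hM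
    exact (ih hV.2 hM.2 rfl).imp fun n h => h.imp_left (List.mem_append_right _)
  | _ => cases hℓ

theorem CastBy.step {Γ : PName → SP IP Data} {ip : IP} {R : Set IP} {m : Msg IP Data}
    {M M' : PNet IP Data} (h : CastBy Γ ip R m M M') : PNetStep Γ M (.cast R m) M' := by
  induction h with
  | node h => exact h
  | left _ h hR hK ih => exact .castLeft ih h hR hK
  | right h _ hR hK ih => exact .castRight h ih hR hK

/-- The invariant of networks: ranges are symmetric and all nodes are sound. -/
def Net.Sound (H : List (Net IP Data)) (N : Net IP Data) : Prop :=
  RangesSymmetric N.nodes ∧ ∀ n ∈ N.nodes, NodeSound H n.1 n.2.1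

theorem vertex_of_mem_nodes {H : List (Net IP Data)} {N : Net IP Data} (hN : N ∈ H)
    {n : IP × PP IP Data × Set IP} (hn : n ∈ N.nodes) : Vertex H n.1 :=
  ⟨N, hN, n.2.1, n.2.2, hn⟩

theorem NetStep.sound {H : List (Net IP Data)} {N N' : Net IP Data} {ℓ : Label IP Data}
    (h : NetStep spec N ℓ N') (hN : N ∈ H) (hs : N.Sound H) : N'.Sound H := by
  have hV : ∀ ip ∈ N.addrs, Vertex H ip := fun ip hip => ⟨N, hN, hip⟩
  have hW : ∀ n ∈ N.nodes, n.1 ∈ N.addrs := fun n hn => ⟨n.2.1, n.2.2, hn⟩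
  cases h with
  | connect h | disconnect h | tau h | deliver h =>
    exact ⟨h.rangesSymmetric hs.1, h.nodeSound hV hW hs.2 trivial⟩
  | newpkt h =>
    exact ⟨h.rangesSymmetric hs.1, h.nodeSound hV hW hs.2 fun _ _ _ => trivial⟩
  | cast h =>
    refine ⟨h.rangesSymmetric hs.1, h.nodeSound hV hW hs.2 ?_⟩
    obtain ⟨n, hn, hR, hm⟩ := h.exists_caster (fun n hn => vertex_of_mem_nodes hN hn) hs.2
    rintro ip hip ⟨P, R, hnode⟩
    refine hm.imp ?_
    rintro _ rfl
    -- the receiver is in the range of the caster, hence the caster in that of the receiver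
    exact ⟨vertex_of_mem_nodes hN hnode, vertex_of_mem_nodes hN hn, _, hN, P, R, hnode,
      (hs.1 n hn _ hnode).1 (hR hip)⟩

/-- Networks reached within `H` satisfy the invariant with respect to the connectivity graph of
the whole of `H`. -/
theorem IsHistory.sound {H H' : List (Net IP Data)} {N : Net IP Data} (h : IsHistory H' N)
    (hH : H' ⊆ H) : N ∈ H ∧ N.Sound H := by
  induction h with
  | init h =>
    exact ⟨hH (List.mem_singleton_self _), h.2.2, fun n hn => (h.2.1 n hn).nodeSound⟩
  | step _ h ih =>
    rw [List.append_subset] at hH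
    obtain ⟨hN, hs⟩ := ih hH.1
    exact ⟨hH.2 (List.mem_singleton_self _), h.sound hN hs⟩

theorem NetCastBy.msgSound {H : List (Net IP Data)} {N N' : Net IP Data} {ip : IP} {R : Set IP}
    {m : Msg IP Data} (h : NetCastBy spec ip R m N N') (hN : N ∈ H) (hs : N.Sound H) :
    ∃ a, MsgSound H (· = a) m := by
  obtain ⟨h⟩ := h
  obtain ⟨n, -, -, hm⟩ := h.step.exists_caster (fun n hn => vertex_of_mem_nodes hN hn) hs.2
  exact ⟨n.1, hm⟩

end AODV

theorem mainTheorem4 {IP Data : Type} (H : List (AODV.Net IP Data)) (N : AODV.Net IP Data)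
    (hH : AODV.IsHistory H N) :
    (∀ (ip : IP) (rt : AODV.RT IP), N.HasRT ip rt → ∀ r ∈ rt.entries,
      ∃ f : ℕ → IP, AODV.IsPath H f r.hops ip r.dip ∧ (0 < r.hops → f 1 = r.nhip)) ∧
    (∀ (ip : IP) (R : Set IP) (N' : AODV.Net IP Data) (hopsc rreqid : ℕ) (dip : IP) (dsn : ℕ)
        (dsk : AODV.SQNK) (oipc : IP) (osn : ℕ) (ipc : IP),
      AODV.NetCastBy AODV.spec ip R (.rreq hopsc rreqid dip dsn dsk oipc osn ipc) N N' →
      ∃ f : ℕ → IP, AODV.IsPath H f hopsc ipc oipc) ∧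
    (∀ (ip : IP) (R : Set IP) (N' : AODV.Net IP Data) (hopsc : ℕ) (dipc : IP) (dsn : ℕ)
        (oip ipc : IP),
      AODV.NetCastBy AODV.spec ip R (.rrep hopsc dipc dsn oip ipc) N N' →
      ∃ f : ℕ → IP, AODV.IsPath H f hopsc ipc dipc) := by
  obtain ⟨hN, hs⟩ := hH.sound (List.Subset.refl H)
  refine ⟨?_, ?_, ?_⟩
  · rintro ip rt ⟨ξ, p, ζ, q, R, hn, hrt⟩ r hr
    obtain ⟨ξ', p', ζ', q', heq, hp, -⟩ := hs.2 _ hn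
    cases heq
    obtain ⟨-, rt', hrt', hsound⟩ := hp.inv
    obtain rfl := Option.some.inj (hrt'.symm.trans hrt)
    exact hsound r hr
  · intro ip R N' hopsc rreqid dip dsn dsk oipc osn ipc h
    obtain ⟨_, hm⟩ := h.msgSound hN hs
    exact hm.2
  · intro ip R N' hopsc dipc dsn oip ipc h
    obtain ⟨_, hm⟩ := h.msgSound hN hs
    exact hm.2
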